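/- Let $d\ge 0$ and $N$ be integers ($N$ of arbitrary sign). For $s\in\mathbb R$ put $\sigma_s(x,\xi)=(1+|x|^2+|\xi|^2)^{s/2}$ on $\mathbb R^{2d}$, and let $\phi(x)=\pi^{-d/4}e^{-|x|^2/2}$. For $f\in\mathscr S'(\mathbb R^d)$ let $$V_\phi f(x,\xi)=(2\pi)^{-d/2}\big\langle f,\ \overline{\phi(\cdot-x)}\,e^{-i\langle\cdot,\xi\rangle}\big\rangle,\qquad (\mathfrak Vf)(z)=\Big\langle f,\ \pi^{-d/4}\exp\Big(-\tfrac12\big(\langle z,z\rangle+|\cdot|^2\big)+\sqrt2\,\langle z,\cdot\rangle\Big)\Big\rangle,\quad z\in\mathbb C^d,$$ where $\langle z,w\rangle=\sum_j z_jw_j$, be its short-time Fourier transform and its Bargmann transform. Let $M^2_{2N}$ be the space of all $f\in\mathscr S'(\mathbb R^d)$ with $\|f\|_{M^2_{2N}}=\|V_\phi f\cdot\sigma_{2N}\|_{L^2(\mathbb R^{2d})}<\infty$, and let $$A_0(\sigma_{2N},L^2)=\{\mathfrak Vf:\ f\in M^2_{2N}\},\qquad \|\mathfrak Vf\|_{A_0(\sigma_{2N},L^2)}=\|f\|_{M^2_{2N}}.$$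 Let $A(\sigma_{2N},L^2)$ be the space of all entire functions $F$ on $\mathbb C^d$ with $$\|F\|_{A(\sigma_{2N},L^2)}=\big\|S\big(Fe^{-|\cdot|^2/2}\big)\,\sigma_{2N}\big\|_{L^2(\mathbb R^{2d})}<\infty,\qquad (SG)(x,\xi)=G\big(2^{-1/2}(x-i\xi)\big).$$ For an entire function $F$ on $\mathbb C^d$ and $\alpha\in\mathbb N^d$ let $a_\alpha=(\partial^\alpha F)(0)/(\alpha!)^{1/2}$, so that $F(z)=\sum_{\alpha}a_\alpha z^\alpha/(\alpha!)^{1/2}$ for all $z\in\mathbb C^d$, and let $\langle\alpha\rangle=(1+|\alpha|^2)^{1/2}$ with $|\alpha|=\alpha_1+\dots+\alpha_d$. Then the following is true. (1) $A_0(\sigma_{2N},L^2)$ consists of exactly those entire functions $F$ on $\mathbb C^d$ for which $$|||F|||=\Big(\sum_{\alpha\in\mathbb N^d}|a_\alpha|^2\langle\alpha\rangle^{2N}\Big)^{1/2}<\infty .$$ Moreover $|||\cdot|||$ is equivalent on this space to $\|\cdot\|_{A(\sigma_{2N},L^2)}$ and to $\|\cdot\|_{A_0(\sigma_{2N},L^2)}$: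 there is a constant $C>0$, depending only on $d$ and $N$, such that $C^{-1}|||F|||\le\|F\|\le C|||F|||$ for each of these two norms and all $F\in A_0(\sigma_{2N},L^2)$. (2) $A(\sigma_{2N},L^2)=A_0(\sigma_{2N},L^2)$; that is, $\mathfrak V$ maps $M^2_{2N}$ onto $A(\sigma_{2N},L^2)$. -/

import Mathlib

open MeasureTheory
open scoped SchwartzMap ContDiff

noncomputable section

namespace Bargmann

/-- `ℝ^d` with its Euclidean norm and Lebesgue measure. -/
abbrev Rd (d : ℕ) : Type := EuclideanSpace ℝ (Fin d)

/-- `ℂ^d`. Only its topology and its complex-linear structure are used; the Euclidean length is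
written out explicitly wherever it occurs. -/
abbrev Cd (d : ℕ) : Type := Fin d → ℂ

/-- The complex-bilinear (not sesquilinear) product `⟨z, w⟩ = ∑ z_j w_j`. -/
def dot {d : ℕ} (z w : Cd d) : ℂ := ∑ j, z j * w j

/-- The inclusion of `ℝ^d` into `ℂ^d`. -/
def toCd {d : ℕ} (y : Rd d) : Cd d := fun j => (y j : ℂ)

/-! ### Gaussian test functions -/

theorem gaussian_decay {d : ℕ} (w : Cd d) :
    ContDiff ℝ ∞ (fun y : Rd d => Complex.exp (-((‖y‖ ^ 2 : ℝ) : ℂ) / 2 + dot w (toCd y))) ∧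
    ∀ k n : ℕ, ∃ C : ℝ, ∀ y : Rd d, ‖y‖ ^ k * ‖iteratedFDeriv ℝ n
      (fun y : Rd d => Complex.exp (-((‖y‖ ^ 2 : ℝ) : ℂ) / 2 + dot w (toCd y))) y‖ ≤ C := by
  let q : Rd d → ℂ := fun y => -((‖y‖ ^ 2 : ℝ) : ℂ) / 2 + dot w (toCd y)
  have hq : q.HasTemperateGrowth := by
    have h1 : Function.HasTemperateGrowth (fun y : Rd d => ‖y‖ ^ 2) := by fun_prop
    have h2 : Function.HasTemperateGrowth (fun y : Rd d => ((‖y‖ ^ 2 : ℝ) : ℂ)) :=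
      (Complex.ofRealCLM.hasTemperateGrowth).comp h1
    have h3 : ∀ j, Function.HasTemperateGrowth (fun y : Rd d => ((y j : ℝ) : ℂ)) := fun j =>
      (Complex.ofRealCLM ∘L (EuclideanSpace.proj j : Rd d →L[ℝ] ℝ)).hasTemperateGrowth
    have h4 : Function.HasTemperateGrowth (fun y : Rd d => ∑ j, w j * (y j : ℂ)) :=
      Function.HasTemperateGrowth.sum fun j _ =>
        (Function.HasTemperateGrowth.const (w j)).fun_mul (h3 j)
    have h5 : Function.HasTemperateGrowth (fun y : Rd d => (-1 / 2 : ℂ) * ((‖y‖ ^ 2 : ℝ) : ℂ)) :=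
      (Function.HasTemperateGrowth.const (-1 / 2 : ℂ)).fun_mul h2
    have h6 := h5.fun_add h4
    convert! h6 using 2 with y
    simp only [q, dot, toCd]
    ring
  have hexpC : ContDiff ℂ ∞ Complex.exp := Complex.contDiff_exp
  have hexp : ContDiff ℝ ∞ Complex.exp := hexpC.restrict_scalars ℝ
  have hsm : ContDiff ℝ ∞ (Complex.exp ∘ q) := hexp.comp hq.1
  refine ⟨hsm, fun k n => ?_⟩
  obtain ⟨m, C, hC0, hC⟩ := hq.norm_iteratedFDeriv_le_uniform n
  have hexpD : ∀ (i : ℕ) (u : ℂ), ‖iteratedFDeriv ℝ i Complex.exp u‖ ≤ ‖Complex.exp u‖ := by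
    intro i u
    rw [← (Complex.contDiff_exp (𝕜 := ℂ) (n := (i : ℕ∞ω))).contDiffAt.restrictScalars_iteratedFDeriv (𝕜 := ℝ)]
    simp only [Function.comp_apply, ContinuousMultilinearMap.norm_restrictScalars]
    rw [norm_iteratedFDeriv_eq_norm_iteratedDeriv, iteratedDeriv_eq_iterate,
      Complex.iter_deriv_exp]
  set K : ℝ := ∑ j, ‖w j‖ with hK
  have hK0 : 0 ≤ K := Finset.sum_nonneg fun j _ => norm_nonneg _
  have hre : ∀ y : Rd d, ‖Complex.exp (q y)‖ ≤ Real.exp (-‖y‖ ^ 2 / 2 + K * ‖y‖) := by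
    intro y
    rw [Complex.norm_exp]
    apply Real.exp_le_exp.2
    have h1 : ‖dot w (toCd y)‖ ≤ K * ‖y‖ := by
      rw [hK, Finset.sum_mul]
      refine (norm_sum_le _ _).trans (Finset.sum_le_sum fun j _ => ?_)
      rw [norm_mul]
      gcongr
      simpa [toCd] using PiLp.norm_apply_le y j
    have h2 : (q y).re = -‖y‖ ^ 2 / 2 + (dot w (toCd y)).re := by
      have : (-((‖y‖ ^ 2 : ℝ) : ℂ) / 2) = ((-‖y‖ ^ 2 / 2 : ℝ) : ℂ) := by push_cast; ring
      simp only [q, Complex.add_re]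
      rw [this, Complex.ofReal_re]
    rw [h2]
    linarith [(Complex.re_le_norm (dot w (toCd y))).trans h1]
  let M : ℕ := k + m * n
  refine ⟨n.factorial * (C + 1) ^ n * (M.factorial * Real.exp (1 + (K + 1) ^ 2 / 2)), fun y => ?_⟩
  set r := ‖y‖ with hr
  have hr0 : 0 ≤ r := norm_nonneg y
  have hD : ∀ i, 1 ≤ i → i ≤ n → ‖iteratedFDeriv ℝ i q y‖ ≤ ((C + 1) * (1 + r) ^ m) ^ i := by
    intro i hi hin
    have h1 : 1 ≤ (1 + r) ^ m := one_le_pow₀ (by linarith)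
    have h2 : 1 ≤ (C + 1) * (1 + r) ^ m := by nlinarith
    refine (hC i hin y).trans ?_
    refine le_trans ?_ (le_self_pow₀ h2 (by omega))
    gcongr
    linarith
  have hmain := norm_iteratedFDeriv_comp_le hexp hq.1 (n := n) (by exact_mod_cast le_top) y
    (fun i _ => (hexpD i (q y)).trans (hre y)) hD
  have hMexp : (1 + r) ^ M ≤ M.factorial * Real.exp (1 + r) := by
    have := Real.pow_div_factorial_le_exp (1 + r) (by linarith) M
    rwa [div_le_iff₀ (by positivity), mul_comm] at this
  calc r ^ k * ‖iteratedFDeriv ℝ n (Complex.exp ∘ q) y‖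
      ≤ (1 + r) ^ k * (n.factorial * Real.exp (-r ^ 2 / 2 + K * r)
          * ((C + 1) * (1 + r) ^ m) ^ n) := by
        gcongr
        linarith
    _ = n.factorial * (C + 1) ^ n * ((1 + r) ^ M * Real.exp (-r ^ 2 / 2 + K * r)) := by
        simp only [M, mul_pow, pow_add, pow_mul]
        ring
    _ ≤ n.factorial * (C + 1) ^ n * ((M.factorial * Real.exp (1 + r))
          * Real.exp (-r ^ 2 / 2 + K * r)) := by gcongr
    _ = n.factorial * (C + 1) ^ n * (M.factorial
          * Real.exp (1 + r + (-r ^ 2 / 2 + K * r))) := by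
        rw [Real.exp_add (1 + r)]
        ring
    _ ≤ _ := by
        gcongr ?_ * (?_ * Real.exp ?_)
        nlinarith [sq_nonneg (r - (K + 1))]

/-- The Schwartz function `y ↦ exp (-|y|² / 2 + ⟨w, y⟩)`, for `w ∈ ℂ^d`. -/
def gaussian {d : ℕ} (w : Cd d) : 𝓢(Rd d, ℂ) where
  toFun y := Complex.exp (-((‖y‖ ^ 2 : ℝ) : ℂ) / 2 + dot w (toCd y))
  smooth' := (gaussian_decay w).1
  decay' := (gaussian_decay w).2

/-- The normalising constant `π ^ (-d/4)`. -/
def gaussConst (d : ℕ) : ℝ := Real.pi ^ (-(d : ℝ) / 4)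

/-- The Bargmann kernel `𝔄_d(z, ·)`, as a Schwartz function of its second variable. The formula
`𝔄_d(z, y) = π ^ (-d/4) * exp (-(⟨z, z⟩ + |y|²) / 2 + √2 ⟨z, y⟩)` is `bargmannKernel_apply`. -/
def bargmannKernel {d : ℕ} (z : Cd d) : 𝓢(Rd d, ℂ) :=
  ((gaussConst d : ℂ) * Complex.exp (-dot z z / 2)) •
    gaussian (fun j => (Real.sqrt 2 : ℂ) * z j)

theorem bargmannKernel_apply {d : ℕ} (z : Cd d) (y : Rd d) :
    bargmannKernel z y = (gaussConst d : ℂ) *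
      Complex.exp (-(dot z z + ((‖y‖ ^ 2 : ℝ) : ℂ)) / 2 + (Real.sqrt 2 : ℂ) * dot z (toCd y)) := by
  change ((gaussConst d : ℂ) * Complex.exp (-dot z z / 2)) *
    Complex.exp (-((‖y‖ ^ 2 : ℝ) : ℂ) / 2 + dot (fun j => (Real.sqrt 2 : ℂ) * z j) (toCd y)) = _
  rw [mul_assoc, ← Complex.exp_add]
  congr 2
  simp only [dot, Finset.mul_sum, mul_assoc]
  ring

/-- The Gaussian window `φ(x) = π ^ (-d/4) * exp (-|x|² / 2)`. -/
def window {d : ℕ} (x : Rd d) : ℂ := ((gaussConst d * Real.exp (-‖x‖ ^ 2 / 2) : ℝ) : ℂ)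

/-- The test function `y ↦ conj (φ (y - x)) * exp (-i ⟨y, ξ⟩)` entering the short-time Fourier
transform; that formula is `stftAtom_apply`. -/
def stftAtom {d : ℕ} (x ξ : Rd d) : 𝓢(Rd d, ℂ) :=
  ((gaussConst d * Real.exp (-‖x‖ ^ 2 / 2) : ℝ) : ℂ) •
    gaussian (fun j => (x j : ℂ) - Complex.I * (ξ j : ℂ))

theorem stftAtom_apply {d : ℕ} (x ξ y : Rd d) :
    stftAtom x ξ y = (starRingEnd ℂ) (window (y - x)) *
      Complex.exp (-Complex.I * (inner ℝ y ξ : ℝ)) := by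
  change ((gaussConst d * Real.exp (-‖x‖ ^ 2 / 2) : ℝ) : ℂ) *
    Complex.exp (-((‖y‖ ^ 2 : ℝ) : ℂ) / 2 +
      dot (fun j => (x j : ℂ) - Complex.I * (ξ j : ℂ)) (toCd y)) = _
  have hd : dot (fun j => (x j : ℂ) - Complex.I * (ξ j : ℂ)) (toCd y)
      = ((inner ℝ y x : ℝ) : ℂ) - Complex.I * ((inner ℝ y ξ : ℝ) : ℂ) := by
    simp only [dot, toCd, PiLp.inner_apply, RCLike.inner_apply, conj_trivial]
    push_cast
    rw [Finset.mul_sum, ← Finset.sum_sub_distrib]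
    exact Finset.sum_congr rfl fun j _ => by ring
  rw [hd, window, Complex.conj_ofReal, norm_sub_sq_real]
  push_cast
  rw [mul_assoc, mul_assoc, ← Complex.exp_add, ← Complex.exp_add]
  congr 2
  ring

/-! ### Short-time Fourier transform, modulation spaces, Bargmann transform -/

/-- The short-time Fourier transform of a tempered distribution with respect to the Gaussian
window: `V_φ f(x, ξ) = 𝓕 (f conj (φ (· - x)))(ξ)
= (2π) ^ (-d/2) ⟨f, conj (φ (· - x)) exp (-i ⟨·, ξ⟩)⟩`. -/
def stft {d : ℕ} (f : 𝓢'(Rd d, ℂ)) (p : Rd d × Rd d) : ℂ :=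
  (((2 * Real.pi) ^ (-(d : ℝ) / 2) : ℝ) : ℂ) * f (stftAtom p.1 p.2)

/-- The weight `σ_s(x, ξ) = (1 + |x|² + |ξ|²) ^ (s/2)` on `ℝ^{2d}`. -/
def sigma {d : ℕ} (s : ℝ) (p : Rd d × Rd d) : ℝ := (1 + ‖p.1‖ ^ 2 + ‖p.2‖ ^ 2) ^ (s / 2)

/-- The modulation space `M(wt, L²)`: the tempered distributions `f` with `V_φ f · wt ∈ L²(ℝ^{2d})`.
For `wt = σ_{2N}` this is `M²_{2N}`. -/
def modulationSpace {d : ℕ} (wt : Rd d × Rd d → ℝ) : Set 𝓢'(Rd d, ℂ) :=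
  {f | MemLp (fun p => stft f p * (wt p : ℂ)) 2 volume}

/-- The norm `‖V_φ f · wt‖_{L²}` of `M(wt, L²)`. -/
def modulationNorm {d : ℕ} (wt : Rd d × Rd d → ℝ) (f : 𝓢'(Rd d, ℂ)) : ℝ :=
  (eLpNorm (fun p => stft f p * (wt p : ℂ)) 2 volume).toReal

/-- The Bargmann transform of a tempered distribution, `(𝔙 f)(z) = ⟨f, 𝔄_d(z, ·)⟩`. -/
def bargmann {d : ℕ} (f : 𝓢'(Rd d, ℂ)) : Cd d → ℂ := fun z => f (bargmannKernel z)

/-- `S (F exp (-|·|² / 2))`, where `(S G)(x, ξ) = G (2^{-1/2} x, -2^{-1/2} ξ)` and `ℝ^{2d}` is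
identified with `ℂ^d` through `(x, ξ) ↦ x + i ξ`. -/
def dilatedGauss {d : ℕ} (F : Cd d → ℂ) (p : Rd d × Rd d) : ℂ :=
  let z : Cd d := fun j =>
    (((Real.sqrt 2)⁻¹ * p.1 j : ℝ) : ℂ) + Complex.I * ((-(Real.sqrt 2)⁻¹ * p.2 j : ℝ) : ℂ)
  F z * ((Real.exp (-(∑ j, ‖z j‖ ^ 2) / 2) : ℝ) : ℂ)

/-- The space `A(wt, L²)`: the entire functions `F` on `ℂ^d` with
`S (F exp (-|·|² / 2)) · wt ∈ L²(ℝ^{2d})`. -/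
def spaceA {d : ℕ} (wt : Rd d × Rd d → ℝ) : Set (Cd d → ℂ) :=
  {F | Differentiable ℂ F ∧ MemLp (fun p => dilatedGauss F p * (wt p : ℂ)) 2 volume}

/-- The norm `‖S (F exp (-|·|² / 2)) · wt‖_{L²}` of `A(wt, L²)`. -/
def normA {d : ℕ} (wt : Rd d × Rd d → ℝ) (F : Cd d → ℂ) : ℝ :=
  (eLpNorm (fun p => dilatedGauss F p * (wt p : ℂ)) 2 volume).toReal

/-- The space `A₀(wt, L²)`: the image of `M(wt, L²)` under the Bargmann transform. -/
def spaceA0 {d : ℕ} (wt : Rd d × Rd d → ℝ) : Set (Cd d → ℂ) := bargmann '' modulationSpace wt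

/-! ### Taylor coefficients -/

/-- The complex partial derivative `∂F/∂z_j`. -/
def partialDeriv {d : ℕ} (j : Fin d) (F : Cd d → ℂ) : Cd d → ℂ :=
  fun z => lineDeriv ℂ F z (Pi.single j 1)

/-- `∂^α F = ∂_1^{α_1} ⋯ ∂_d^{α_d} F` for a multi-index `α`. -/
def multiDeriv {d : ℕ} (α : Fin d → ℕ) (F : Cd d → ℂ) : Cd d → ℂ :=
  (List.finRange d).foldr (fun j G => (partialDeriv j)^[α j] G) F

/-- `α! = ∏ α_j!`. -/
def multiFactorial {d : ℕ} (α : Fin d → ℕ) : ℕ := ∏ j, (α j).factorial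

/-- The normalised Taylor coefficient `a_α = (∂^α F)(0) / (α!)^{1/2}`. -/
def taylorCoeff {d : ℕ} (F : Cd d → ℂ) (α : Fin d → ℕ) : ℂ :=
  multiDeriv α F 0 / (Real.sqrt (multiFactorial α) : ℂ)

/-- The normalised monomial `z^α / (α!)^{1/2}`. -/
def monomialFn {d : ℕ} (α : Fin d → ℕ) (z : Cd d) : ℂ :=
  (∏ j, z j ^ α j) / (Real.sqrt (multiFactorial α) : ℂ)

/-- `⟨α⟩ = (1 + |α|²)^{1/2}` with `|α| = ∑ α_j`. -/
def japanese {d : ℕ} (α : Fin d → ℕ) : ℝ := Real.sqrt (1 + ((∑ j, α j : ℕ) : ℝ) ^ 2)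

/-- The summand `|a_α ⟨α⟩^N|² = |a_α|² ⟨α⟩^{2N}`, for an integer `N`. -/
def coeffTerm {d : ℕ} (N : ℤ) (F : Cd d → ℂ) (α : Fin d → ℕ) : ℝ :=
  ‖taylorCoeff F α‖ ^ 2 * japanese α ^ (2 * N)

/-- `‖(a_α ⟨α⟩^N)_α‖_{ℓ²}`; it is used only where the family `coeffTerm N F` is summable. -/
def coeffNorm {d : ℕ} (N : ℤ) (F : Cd d → ℂ) : ℝ := Real.sqrt (∑' α, coeffTerm N F α)

end Bargmann

end

noncomputable section

namespace Bargmann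

/-! ### Partial derivatives of entire functions -/

/-! Everything is carried to ℂ^d by z = 2^{-1/2}(x - iξ). There the test function of the short-time
Fourier transform is a scalar multiple of the Bargmann kernel at z, the scalar having modulus
e^{-|z|²/2}. So |V_φ f| is pointwise (2π)^{-d/2} times |S(𝔙f e^{-|·|²/2})| (`norm_stft`), the two
function space norms are proportional, and σ_{2N} becomes (1 + 2|z|²)^N. Two facts remain.

Norm equivalence. For entire F the squared A-norm is a constant times ∫ |F|² e^{-|z|²} (1 +
2|z|²)^{2N}. The weight is invariant under rotating each coordinate, so monomials are orthogonal and
the integral is ∑ |a_α|² m_α, where m_α is the weighted squared norm of z^α/√(α!)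
(`lintegral_enorm_sq_mul_weight`). The density |z^α|² e^{-|z|²}/α! has mass π^d and concentrates
where |z|² is of size |α|, so m_α is comparable to ⟨α⟩^{2N} (`moment_le`, `le_moment`).

Surjectivity. Given F with finite coefficient norm, put f(φ) = ∑ a_α(F) a_α(𝔙φ). Since 𝔙 turns y_j -
∂_j into multiplication by √2 z_j, the function 𝔙φ · e^{-|z|²/2} decays faster than every power,
with bounds continuous in φ; Cauchy–Schwarz then makes f tempered
(`exists_coeffNorm_bargmann_distr_le`, `coeff_pairing`). The kernel at z has Bargmann transform w ↦
e^{⟨z,w⟩}, whose coefficients are z^α/√(α!), so 𝔙f(z) is the Taylor series of F at z. Conversely 𝔙f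
is entire for every tempered f (`differentiable_bargmann`). -/

theorem exists_bound_closedBall {d : ℕ} {F : Cd d → ℂ} (hF : Continuous F) (r : ℝ) :
    ∃ M : ℝ, 0 ≤ M ∧ ∀ z : Cd d, ‖z‖ ≤ r → ‖F z‖ ≤ M := by
  obtain ⟨M, hM⟩ := (isCompact_closedBall (0 : Cd d) r).exists_bound_of_continuousOn
    hF.continuousOn
  exact ⟨max M 0, le_max_right _ _, fun z hz => (hM z (by simpa using hz)).trans (le_max_left _ _)⟩

/-- Differentiation under the integral sign. The derivative of F is only known to be measurable at
this stage, so domination comes from a Lipschitz bound: F is bounded by M near the compact curve,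
and the Schwarz lemma on unit balls gives the constant 2M. -/
theorem differentiable_integral_translates {d : ℕ} {F : Cd d → ℂ} (hF : Differentiable ℂ F)
    {k : ℝ → ℂ} {γ : ℝ → Cd d} (hk : Continuous k) (hγ : Continuous γ) {a b : ℝ} (hab : a ≤ b) :
    Differentiable ℂ (fun z => ∫ t in a..b, k t * F (z + γ t)) := by
  intro z₀
  obtain ⟨R, hR⟩ := (isCompact_Icc (a := a) (b := b)).exists_bound_of_continuousOn hγ.continuousOn
  obtain ⟨M, hM0, hM⟩ := exists_bound_closedBall hF.continuous (‖z₀‖ + R + 2)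
  simp only [intervalIntegral.integral_of_le hab]
  have hc : ∀ z, Continuous (fun t => k t * F (z + γ t)) := fun z =>
    hk.mul (hF.continuous.comp (by fun_prop))
  refine (hasFDerivAt_integral_of_dominated_loc_of_lip' (𝕜 := ℂ)
    (F' := fun t => k t • fderiv ℂ F (z₀ + γ t)) (bound := fun t => ‖k t‖ * (2 * M / 1))
    (Metric.ball_mem_nhds z₀ one_pos)
    (fun z _ => (hc z).aestronglyMeasurable) ?_ ?_ ?_ ?_ ?_).2.differentiableAt
  · exact ((hc z₀).integrableOn_Icc).mono_set Set.Ioc_subset_Icc_self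
  · exact (hk.measurable.smul ((measurable_fderiv ℂ F).comp
      (by fun_prop : Measurable fun t => z₀ + γ t))).aestronglyMeasurable
  · refine (ae_restrict_iff' measurableSet_Ioc).2 (Filter.Eventually.of_forall fun t ht z hz => ?_)
    have hγt := hR t (Set.Ioc_subset_Icc_self ht)
    have hball : ∀ w ∈ Metric.ball (z₀ + γ t) 1, ‖F w‖ ≤ M := fun w hw => by
      apply hM
      have h1 : ‖w - (z₀ + γ t)‖ < 1 := by simpa [dist_eq_norm] using hw
      have h2 : ‖w‖ ≤ ‖w - (z₀ + γ t)‖ + ‖z₀ + γ t‖ := by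
        simpa using norm_add_le (w - (z₀ + γ t)) (z₀ + γ t)
      have h3 := norm_add_le z₀ (γ t)
      linarith
    have hz' : z + γ t ∈ Metric.ball (z₀ + γ t) 1 := by simpa using hz
    have h := Complex.dist_le_div_mul_dist_of_mapsTo_ball (f := F) (R₂ := 2 * M)
      hF.differentiableOn (fun w hw => by
        rw [mem_closedBall_iff_norm]
        have h1 := norm_sub_le (F w) (F (z₀ + γ t))
        have h2 := hball w hw
        have h3 := hball (z₀ + γ t) (by simp)
        linarith) hz'
    rw [← mul_sub, norm_mul, mul_assoc]
    gcongr
    simpa [dist_eq_norm] using h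
  · exact ((hk.norm.mul continuous_const).integrableOn_Icc).mono_set Set.Ioc_subset_Icc_self
  · refine Filter.Eventually.of_forall fun t => ?_
    have h := (hF (z₀ + γ t)).hasFDerivAt
    have h2 : HasFDerivAt (fun z => F (z + γ t)) (fderiv ℂ F (z₀ + γ t)) z₀ := by
      have h3 := h.comp z₀ ((hasFDerivAt_id z₀).add_const (γ t))
      rw [ContinuousLinearMap.comp_id] at h3
      exact h3
    simpa using h2.const_mul (k t)

/-- Cauchy's formula on the unit circle in direction j writes the partial derivative as a weighted
average of translates of F. -/
theorem differentiable_partialDeriv {d : ℕ} {F : Cd d → ℂ} (hF : Differentiable ℂ F) (j : Fin d) :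
    Differentiable ℂ (partialDeriv j F) := by
  have hd : ∀ z, Differentiable ℂ (fun t : ℂ => F (z + t • Pi.single j (1 : ℂ))) := fun z =>
    hF.comp (by fun_prop)
  have key : partialDeriv j F = fun z => (2 * (Real.pi : ℂ) * Complex.I)⁻¹ *
      ∫ t in (0 : ℝ)..(2 * Real.pi), (deriv (circleMap 0 1) t * (circleMap 0 1 t ^ 2)⁻¹) *
        F (z + circleMap 0 1 t • Pi.single j (1 : ℂ)) := by
    funext z
    have h := ((hd z).differentiableOn (s := Metric.closedBall 0 1)).deriv_eq_smul_circleIntegral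
      one_pos
    simp only [partialDeriv, lineDeriv]
    rw [eq_inv_mul_iff_mul_eq₀ (by simp [Real.pi_ne_zero])]
    simp only [circleIntegral, sub_zero, one_div, smul_eq_mul] at h
    rw [← h]
    congr 1
    funext t
    ring
  rw [key]
  refine (differentiable_integral_translates hF ?_ ?_ (by positivity)).const_mul _
  · have h1 : ∀ t, circleMap 0 1 t ^ 2 ≠ 0 := fun t => pow_ne_zero _ (by simp)
    have h2 : Continuous (deriv (circleMap 0 1)) := by
      have h3 : deriv (circleMap 0 1) = fun t => circleMap 0 1 t * Complex.I := by
        funext t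
        simp
      rw [h3]
      fun_prop
    exact h2.mul (((continuous_circleMap 0 1).pow 2).inv₀ h1)
  · exact (continuous_circleMap 0 1).smul continuous_const

theorem iterate_partialDeriv_apply {d : ℕ} (j : Fin d) (k : ℕ) (F : Cd d → ℂ) (z : Cd d) (t : ℂ) :
    (partialDeriv j)^[k] F (z + t • Pi.single j 1) =
      iteratedDeriv k (fun s : ℂ => F (z + s • Pi.single j (1 : ℂ))) t := by
  induction k generalizing t with
  | zero => simp
  | succ k ih =>
    rw [Function.iterate_succ_apply', iteratedDeriv_succ, partialDeriv, lineDeriv]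
    simp only [add_assoc, ← add_smul, ih]
    rw [deriv_comp_const_add, add_zero]

theorem differentiable_iterate_partialDeriv {d : ℕ} {F : Cd d → ℂ} (hF : Differentiable ℂ F)
    (j : Fin d) (k : ℕ) : Differentiable ℂ ((partialDeriv j)^[k] F) := by
  induction k with
  | zero => exact hF
  | succ k ih => rw [Function.iterate_succ_apply']; exact differentiable_partialDeriv ih j

theorem norm_iterate_partialDeriv_le {d : ℕ} {F : Cd d → ℂ} (hF : Differentiable ℂ F)
    (j : Fin d) (k : ℕ) {r R M : ℝ} (hR : 0 < R) (hM : ∀ z, ‖z‖ ≤ r + R → ‖F z‖ ≤ M)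
    (z : Cd d) (hz : ‖z‖ ≤ r) : ‖(partialDeriv j)^[k] F z‖ ≤ k.factorial * M / R ^ k := by
  have h := iterate_partialDeriv_apply j k F z 0
  rw [zero_smul, add_zero] at h
  rw [h]
  have hd : Differentiable ℂ (fun t : ℂ => F (z + t • Pi.single j (1 : ℂ))) :=
    hF.comp (by fun_prop)
  refine Complex.norm_iteratedDeriv_le_of_forall_mem_sphere_norm_le k hR hd.diffContOnCl
    fun w hw => hM _ ?_
  have hw' : ‖w‖ = R := by simpa using hw
  refine (norm_add_le _ _).trans (add_le_add hz ?_)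
  rw [norm_smul, hw', Pi.norm_single]
  simp

theorem partialDeriv_add {d : ℕ} {F G : Cd d → ℂ} (hF : Differentiable ℂ F)
    (hG : Differentiable ℂ G) (j : Fin d) :
    partialDeriv j (F + G) = partialDeriv j F + partialDeriv j G := by
  funext z
  exact deriv_fun_add (f := fun t : ℂ => F (z + t • Pi.single j (1 : ℂ)))
    (g := fun t : ℂ => G (z + t • Pi.single j (1 : ℂ)))
    ((hF.comp (by fun_prop)).differentiableAt) ((hG.comp (by fun_prop)).differentiableAt)

theorem partialDeriv_smul {d : ℕ} (c : ℂ) (F : Cd d → ℂ) (j : Fin d) :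
    partialDeriv j (c • F) = c • partialDeriv j F := by
  funext z
  exact deriv_const_smul_field c (fun t : ℂ => F (z + t • Pi.single j (1 : ℂ)))

/-- The composition of the operators `∂_j ^ α_j` along a list of indices. -/
def listDeriv {d : ℕ} (α : Fin d → ℕ) (l : List (Fin d)) (F : Cd d → ℂ) : Cd d → ℂ :=
  l.foldr (fun j G => (partialDeriv j)^[α j] G) F

theorem listDeriv_cons {d : ℕ} (α : Fin d → ℕ) (j : Fin d) (l : List (Fin d)) (F : Cd d → ℂ) :
    listDeriv α (j :: l) F = (partialDeriv j)^[α j] (listDeriv α l F) := rfl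

theorem differentiable_listDeriv {d : ℕ} {F : Cd d → ℂ} (hF : Differentiable ℂ F)
    (α : Fin d → ℕ) (l : List (Fin d)) : Differentiable ℂ (listDeriv α l F) := by
  induction l with
  | nil => exact hF
  | cons j l ih => exact differentiable_iterate_partialDeriv ih j _

theorem listDeriv_add {d : ℕ} {F G : Cd d → ℂ} (hF : Differentiable ℂ F)
    (hG : Differentiable ℂ G) (α : Fin d → ℕ) (l : List (Fin d)) :
    listDeriv α l (F + G) = listDeriv α l F + listDeriv α l G := by
  have hit : ∀ (j : Fin d) (k : ℕ) (F G : Cd d → ℂ), Differentiable ℂ F → Differentiable ℂ G →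
      (partialDeriv j)^[k] (F + G) = (partialDeriv j)^[k] F + (partialDeriv j)^[k] G := by
    intro j k
    induction k with
    | zero => intros; rfl
    | succ k ih =>
      intro F G hF hG
      rw [Function.iterate_succ_apply, partialDeriv_add hF hG,
        ih _ _ (differentiable_partialDeriv hF j) (differentiable_partialDeriv hG j)]
      rfl
  induction l with
  | nil => rfl
  | cons j l ih =>
    rw [listDeriv_cons, ih, hit _ _ _ _ (differentiable_listDeriv hF α l)
      (differentiable_listDeriv hG α l)]
    rfl

theorem listDeriv_smul {d : ℕ} (c : ℂ) (F : Cd d → ℂ) (α : Fin d → ℕ) (l : List (Fin d)) :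
    listDeriv α l (c • F) = c • listDeriv α l F := by
  have hit : ∀ (j : Fin d) (k : ℕ) (F : Cd d → ℂ),
      (partialDeriv j)^[k] (c • F) = c • (partialDeriv j)^[k] F := by
    intro j k
    induction k with
    | zero => intros; rfl
    | succ k ih =>
      intro F
      rw [Function.iterate_succ_apply, partialDeriv_smul, ih]
      rfl
  induction l with
  | nil => rfl
  | cons j l ih => rw [listDeriv_cons, ih, hit]; rfl

theorem taylorCoeff_add {d : ℕ} {F G : Cd d → ℂ} (hF : Differentiable ℂ F)
    (hG : Differentiable ℂ G) (α : Fin d → ℕ) :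
    taylorCoeff (F + G) α = taylorCoeff F α + taylorCoeff G α := by
  have h := congrFun (listDeriv_add hF hG α (List.finRange d)) 0
  change listDeriv α (List.finRange d) (F + G) 0 / _ = listDeriv α (List.finRange d) F 0 / _ +
    listDeriv α (List.finRange d) G 0 / _
  rw [h, Pi.add_apply, add_div]

theorem taylorCoeff_smul {d : ℕ} (c : ℂ) (F : Cd d → ℂ) (α : Fin d → ℕ) :
    taylorCoeff (c • F) α = c * taylorCoeff F α := by
  have h := congrFun (listDeriv_smul c F α (List.finRange d)) 0
  change listDeriv α (List.finRange d) (c • F) 0 / _ = c * (listDeriv α (List.finRange d) F 0 / _)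
  rw [h, Pi.smul_apply, smul_eq_mul, mul_div_assoc]

/-- **Cauchy estimates** for iterated partial derivatives. -/
theorem norm_listDeriv_le {d : ℕ} {F : Cd d → ℂ} (hF : Differentiable ℂ F)
    (α : Fin d → ℕ) (l : List (Fin d)) {r R M : ℝ} (hR : 0 < R)
    (hM : ∀ z, ‖z‖ ≤ r + l.length * R → ‖F z‖ ≤ M) (z : Cd d) (hz : ‖z‖ ≤ r) :
    ‖listDeriv α l F z‖ ≤ (l.map fun j => ((α j).factorial : ℝ) / R ^ α j).prod * M := by
  induction l generalizing r z with
  | nil => simpa [listDeriv] using hM z (by simpa using hz)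
  | cons j l ih =>
    rw [listDeriv_cons]
    -- Each index of the list spends R of the available radius, so the inductive bound is used on
    -- the ball of radius r + R.
    refine (norm_iterate_partialDeriv_le (differentiable_listDeriv hF α l) j (α j) hR
      (fun w hw => ih (r := r + R) (fun u hu => hM u (hu.trans ?_)) w hw) z hz).trans_eq ?_
    · push_cast [List.length_cons]
      linarith
    · simp only [List.map_cons, List.prod_cons]
      ring

theorem norm_multiDeriv_le {d : ℕ} {F : Cd d → ℂ} (hF : Differentiable ℂ F)
    {R M : ℝ} (hR : 0 < R) (hM : ∀ z, ‖z‖ ≤ d * R → ‖F z‖ ≤ M) (α : Fin d → ℕ) :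
    ‖multiDeriv α F 0‖ ≤ (∏ j, ((α j).factorial : ℝ) / R ^ α j) * M := by
  have h := norm_listDeriv_le hF α (List.finRange d) (r := 0) hR (M := M)
    (by simpa using hM) 0 (by simp)
  rwa [← Fin.prod_univ_def] at h

/-! ### Taylor expansion of entire functions -/

theorem summable_prod_pow {d : ℕ} (x : Fin d → ℝ) (h0 : ∀ j, 0 ≤ x j) (h1 : ∀ j, x j < 1) :
    Summable (fun α : Fin d → ℕ => ∏ j, x j ^ α j) := by
  induction d with
  | zero => exact (hasSum_fintype _).summable
  | succ d ih =>
    rw [← (Fin.consEquiv fun _ => ℕ).summable_iff]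
    have h := (summable_geometric_of_lt_one (h0 0) (h1 0)).mul_of_nonneg
      (ih (fun j => x j.succ) (fun j => h0 _) (fun j => h1 _))
      (fun n => pow_nonneg (h0 0) n) (fun α => Finset.prod_nonneg fun j _ => pow_nonneg (h0 _) _)
    refine h.congr fun p => ?_
    simp [Fin.consEquiv, Fin.prod_univ_succ]

theorem multiFactorial_pos {d : ℕ} (α : Fin d → ℕ) : 0 < multiFactorial α :=
  Finset.prod_pos fun j _ => (α j).factorial_pos

theorem multiFactorial_succ {d : ℕ} (α : Fin (d + 1) → ℕ) :
    multiFactorial α = (α 0).factorial * multiFactorial (Fin.tail α) := by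
  simp [multiFactorial, Fin.prod_univ_succ, Fin.tail]

theorem taylorCoeff_mul_monomialFn {d : ℕ} (F : Cd d → ℂ) (α : Fin d → ℕ) (z : Cd d) :
    taylorCoeff F α * monomialFn α z = multiDeriv α F 0 / multiFactorial α * ∏ j, z j ^ α j := by
  have h : (Real.sqrt (multiFactorial α) : ℂ) * (Real.sqrt (multiFactorial α) : ℂ)
      = multiFactorial α := by
    rw [← Complex.ofReal_mul, Real.mul_self_sqrt (by positivity)]
    simp
  rw [taylorCoeff, monomialFn, div_mul_div_comm, h]
  ring

/-- The Cauchy estimates with R = ‖z‖ + 1, which exceeds every |z_j|, dominate the series by a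
product of geometric series. -/
theorem summable_multiDeriv {d : ℕ} {F : Cd d → ℂ} (hF : Differentiable ℂ F) (z : Cd d) :
    Summable (fun α : Fin d → ℕ => multiDeriv α F 0 / multiFactorial α * ∏ j, z j ^ α j) := by
  have hR : 0 < ‖z‖ + 1 := by positivity
  obtain ⟨M, hM0, hM⟩ := exists_bound_closedBall hF.continuous (d * (‖z‖ + 1))
  have hs := (summable_prod_pow (fun j => ‖z j‖ / (‖z‖ + 1)) (fun j => by positivity)
    (fun j => by rw [div_lt_one hR]; linarith [norm_le_pi_norm z j])).mul_right M
  refine Summable.of_norm_bounded hs fun α => ?_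
  have h := norm_multiDeriv_le hF hR hM α
  have hf : (0 : ℝ) < multiFactorial α := by exact_mod_cast multiFactorial_pos α
  rw [norm_mul, norm_div, norm_prod, Complex.norm_natCast]
  calc ‖multiDeriv α F 0‖ / multiFactorial α * ∏ j, ‖z j ^ α j‖
      ≤ ((∏ j, ((α j).factorial : ℝ) / (‖z‖ + 1) ^ α j) * M) / multiFactorial α *
        ∏ j, ‖z j ^ α j‖ := by gcongr
    _ = _ := by
      simp only [Finset.prod_div_distrib, norm_pow, div_pow]
      have : (∏ j, ((α j).factorial : ℝ)) = multiFactorial α := by simp [multiFactorial]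
      rw [this]
      field_simp

theorem cons_add_smul_single {d : ℕ} (z₀ t : ℂ) (u : Cd d) (j : Fin d) :
    (Fin.cons z₀ (u + t • Pi.single j (1 : ℂ)) : Cd (d + 1)) =
      (Fin.cons z₀ u : Cd (d + 1)) + t • Pi.single j.succ (1 : ℂ) := by
  funext i
  refine Fin.cases ?_ (fun i => ?_) i
  · simp
  · simp [Pi.single_apply, Fin.succ_inj]

/-- Freezing the first coordinate commutes with differentiation in the others; this drives the
induction on the dimension. -/
theorem listDeriv_comp_cons {d : ℕ} (F : Cd (d + 1) → ℂ) (α : Fin (d + 1) → ℕ) (z₀ : ℂ)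
    (l : List (Fin d)) (u : Cd d) :
    listDeriv (Fin.tail α) l (fun v => F (Fin.cons z₀ v : Cd (d + 1))) u =
      listDeriv α (l.map Fin.succ) F (Fin.cons z₀ u : Cd (d + 1)) := by
  have hit : ∀ (j : Fin d) (k : ℕ) (G : Cd (d + 1) → ℂ),
      (partialDeriv j)^[k] (fun v => G (Fin.cons z₀ v : Cd (d + 1))) =
        fun v => (partialDeriv j.succ)^[k] G (Fin.cons z₀ v : Cd (d + 1)) := by
    intro j k
    induction k with
    | zero => intros; rfl
    | succ k ih =>
      intro G
      rw [Function.iterate_succ_apply, Function.iterate_succ_apply, ← ih]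
      congr 1
      funext v
      simp only [partialDeriv, lineDeriv, cons_add_smul_single]
  induction l generalizing u with
  | nil => rfl
  | cons j l ih =>
    rw [List.map_cons, listDeriv_cons, listDeriv_cons, funext ih, hit]
    rfl

/-- Induction on d. For fixed β, summing over the exponent k of the first variable is a one-variable
Taylor expansion of ∂^β F along the first axis; summing over β is the induction hypothesis for the
slice with first coordinate z₀. Absolute summability allows the iterated sum to be regrouped. -/
theorem hasSum_multiDeriv {d : ℕ} {F : Cd d → ℂ} (hF : Differentiable ℂ F) (z : Cd d) :
    HasSum (fun α : Fin d → ℕ => multiDeriv α F 0 / multiFactorial α * ∏ j, z j ^ α j) (F z) := by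
  induction d with
  | zero =>
    have hz : z = 0 := Subsingleton.elim _ _
    subst hz
    convert! hasSum_unique (fun α : Fin 0 → ℕ =>
      multiDeriv α F 0 / multiFactorial α * ∏ j, (0 : Cd 0) j ^ α j) using 1
    simp [multiDeriv, multiFactorial]
  | succ d ih =>
    set z₀ := z 0
    set u : Cd d := Fin.tail z
    have hz : z = (Fin.cons z₀ u : Cd (d + 1)) := (Fin.cons_self_tail z).symm
    have hF' : Differentiable ℂ (fun v : Cd d => F (Fin.cons z₀ v : Cd (d + 1))) := by
      refine hF.comp (differentiable_pi.2 fun i => ?_)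
      refine Fin.cases ?_ (fun i => ?_) i
      · simp
      · simp only [Fin.cons_succ]
        fun_prop
    have hsum := summable_multiDeriv hF z
    rw [← (Fin.consEquiv fun _ => ℕ).summable_iff, ← (Equiv.prodComm _ _).summable_iff] at hsum
    have hfib : ∀ β : Fin d → ℕ, HasSum (fun k : ℕ => multiDeriv (Fin.cons k β) F 0 /
        multiFactorial (Fin.cons k β : Fin (d + 1) → ℕ) *
          ∏ j, z j ^ (Fin.cons k β : Fin (d + 1) → ℕ) j)
        (multiDeriv β (fun v : Cd d => F (Fin.cons z₀ v : Cd (d + 1))) 0 / multiFactorial β *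
          ∏ j, u j ^ β j) := by
      intro β
      set H : ℕ → Cd (d + 1) → ℂ := fun k =>
        listDeriv (Fin.cons k β) ((List.finRange d).map Fin.succ) F with hH
      -- `H k` differentiates only in the last d variables, so the zeroth entry k of the multi-index
      -- plays no role.
      have hH0 : ∀ k, H k = H 0 := by
        intro k
        funext w
        rw [← Fin.cons_self_tail w, hH]
        simp only
        rw [← listDeriv_comp_cons, ← listDeriv_comp_cons, Fin.tail_cons, Fin.tail_cons]
      -- In `multiDeriv` the derivative of index 0 is applied last, so it acts on `H 0` from
      -- outside.
      have hmd : ∀ k, multiDeriv (Fin.cons k β) F 0 = (partialDeriv 0)^[k] (H 0) 0 := by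
        intro k
        rw [← hH0 k]
        change listDeriv _ _ _ _ = _
        rw [List.finRange_succ, listDeriv_cons, Fin.cons_zero]
      have hH0d : Differentiable ℂ (H 0) := differentiable_listDeriv hF _ _
      have hval : multiDeriv β (fun v : Cd d => F (Fin.cons z₀ v : Cd (d + 1))) 0 =
          H 0 (0 + z₀ • Pi.single 0 (1 : ℂ)) := by
        have h := listDeriv_comp_cons F (Fin.cons 0 β) z₀ (List.finRange d) 0
        rw [Fin.tail_cons] at h
        refine h.trans ?_
        congr 1
        funext i
        refine Fin.cases ?_ (fun i => ?_) i <;> simp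
      have ht := Complex.hasSum_taylorSeries_of_entire
        (f := fun t : ℂ => H 0 (0 + t • Pi.single 0 (1 : ℂ))) (hH0d.comp (by fun_prop)) 0 z₀
      rw [hval]
      have ht' := (ht.mul_right ((multiFactorial β : ℂ)⁻¹ * ∏ j, u j ^ β j))
      convert! ht' using 1
      · funext k
        have h0 := iterate_partialDeriv_apply 0 k (H 0) 0 0
        rw [zero_smul, add_zero] at h0
        rw [hmd, h0, multiFactorial_succ, Fin.prod_univ_succ, Fin.cons_zero, Fin.tail_cons]
        simp only [Fin.cons_succ, sub_zero, smul_eq_mul]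
        push_cast
        change _ * (z₀ ^ k * ∏ j, u j ^ β j) = _
        rw [div_eq_mul_inv, mul_inv]
        ring
      · ring
    have htot := hsum.hasSum.prod_fiberwise hfib
    have hF1 := htot.unique (ih hF' u)
    rw [← hz] at hF1
    rw [← hF1, ← (Fin.consEquiv fun _ => ℕ).hasSum_iff, ← (Equiv.prodComm _ _).hasSum_iff]
    exact hsum.hasSum

theorem hasSum_taylorCoeff {d : ℕ} {F : Cd d → ℂ} (hF : Differentiable ℂ F) (z : Cd d) :
    HasSum (fun α : Fin d → ℕ => taylorCoeff F α * monomialFn α z) (F z) := by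
  simpa only [taylorCoeff_mul_monomialFn] using hasSum_multiDeriv hF z

/-! ### Orthogonality of monomials for rotation invariant weights -/

theorem hasSum_norm_sq_of_orthonormal {ι E : Type*} [NormedAddCommGroup E] [InnerProductSpace ℂ E]
    {v : ι → E} (hv : Orthonormal ℂ v) {c : ι → ℂ} {x : E} (h : HasSum (fun i => c i • v i) x) :
    HasSum (fun i => ‖c i‖ ^ 2) (‖x‖ ^ 2) := by
  have h1 : Filter.Tendsto (fun s : Finset ι => ‖∑ i ∈ s, c i • v i‖ ^ 2) Filter.atTop
    (nhds (‖x‖ ^ 2)) := (Filter.Tendsto.norm h).pow 2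
  refine h1.congr fun s => ?_
  have h2 : ((‖∑ i ∈ s, c i • v i‖ ^ 2 : ℝ) : ℂ) = ((∑ i ∈ s, ‖c i‖ ^ 2 : ℝ) : ℂ) := by
    have h3 := inner_self_eq_norm_sq_to_K (𝕜 := ℂ) (∑ i ∈ s, c i • v i)
    rw [hv.inner_sum] at h3
    push_cast
    refine h3.symm.trans ?_
    refine Finset.sum_congr rfl fun i _ => ?_
    rw [mul_comm, Complex.mul_conj, Complex.normSq_eq_norm_sq]
    push_cast
    rfl
  exact_mod_cast h2

/-- The normalised Haar measure of the torus. -/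
abbrev torusMeasure (d : ℕ) : Measure (UnitAddTorus (Fin d)) :=
  Measure.pi fun _ => AddCircle.haarAddCircle

/-- Absolute summability makes the Fourier series converge uniformly, hence in L² of the torus,
where the characters are orthonormal. -/
theorem lintegral_enorm_sq_tsum_mFourier {d : ℕ} {c : (Fin d → ℕ) → ℂ} (hc : Summable c)
    {f : UnitAddTorus (Fin d) → ℂ}
    (hf : ∀ θ, HasSum (fun α => c α * UnitAddTorus.mFourier (fun j => (α j : ℤ)) θ) (f θ)) :
    ∫⁻ θ, ‖f θ‖ₑ ^ 2 ∂torusMeasure d = ∑' α, ‖c α‖ₑ ^ 2 := by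
  have hs : Summable (fun α => c α • UnitAddTorus.mFourier (d := Fin d) (fun j => (α j : ℤ))) := by
    refine Summable.of_norm_bounded hc.norm fun α => ?_
    rw [norm_smul, UnitAddTorus.mFourier_norm, mul_one]
  obtain ⟨g, hg⟩ := hs
  have hfg : f = g := by
    funext θ
    have h := hg.mapL (ContinuousMap.evalCLM ℂ θ)
    exact (hf θ).unique (by simpa using h)
  have hv : Orthonormal ℂ (fun α : Fin d → ℕ => ContinuousMap.toLp (E := ℂ) 2 (torusMeasure d) ℂ
      (UnitAddTorus.mFourier (fun j => (α j : ℤ)))) :=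
    UnitAddTorus.orthonormal_mFourier.comp _ fun α β h => funext fun j => by
      exact_mod_cast congrFun h j
  have h2 := hg.mapL (ContinuousMap.toLp (E := ℂ) 2 (torusMeasure d) ℂ)
  simp only [map_smul] at h2
  have h3 := hasSum_norm_sq_of_orthonormal hv (c := c) (x := ContinuousMap.toLp (E := ℂ) 2
      (torusMeasure d) ℂ g) h2
  have h4 : ∑' α, ‖c α‖ₑ ^ 2 = ENNReal.ofReal (‖ContinuousMap.toLp (E := ℂ) 2
      (torusMeasure d) ℂ g‖ ^ 2) := by
    rw [← h3.tsum_eq, ENNReal.ofReal_tsum_of_nonneg (fun _ => by positivity) h3.summable]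
    simp [ENNReal.ofReal_pow]
  have h5 : eLpNorm (ContinuousMap.toLp (E := ℂ) 2
      (torusMeasure d) ℂ g) 2 (torusMeasure d) = eLpNorm g 2 (torusMeasure d) :=
    eLpNorm_congr_ae (ContinuousMap.coeFn_toLp (torusMeasure d) g)
  have h6 := eLpNorm_nnreal_pow_eq_lintegral (f := (g : UnitAddTorus (Fin d) → ℂ))
    (μ := torusMeasure d) (p := 2) (by norm_num)
  rw [h4, hfg, ENNReal.ofReal_pow (norm_nonneg _), Lp.norm_def, h5, ENNReal.ofReal_toReal
    (by rw [← h5]; exact Lp.eLpNorm_ne_top _)]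
  simpa using h6.symm

/-- Coordinatewise rotation of `ℂ^d` by an element of the torus. -/
def rotate {d : ℕ} (θ : UnitAddTorus (Fin d)) (w : Cd d) : Cd d :=
  fun j => ((θ j).toCircle : ℂ) * w j

theorem continuous_rotate {d : ℕ} :
    Continuous (fun p : UnitAddTorus (Fin d) × Cd d => rotate p.1 p.2) := by
  refine continuous_pi fun j => ?_
  have h : Continuous (fun p : UnitAddTorus (Fin d) × Cd d => ((p.1 j).toCircle : ℂ)) :=
    continuous_subtype_val.comp (AddCircle.continuous_toCircle.comp (by fun_prop))
  exact h.mul (by fun_prop)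

theorem norm_rotate_apply {d : ℕ} (θ : UnitAddTorus (Fin d)) (w : Cd d) (j : Fin d) :
    ‖rotate θ w j‖ = ‖w j‖ := by
  simp [rotate, Circle.norm_coe]

theorem measurePreserving_rotate {d : ℕ} (θ : UnitAddTorus (Fin d)) :
    MeasurePreserving (rotate θ) (volume : Measure (Cd d)) volume :=
  volume_preserving_pi fun j => (rotation (θ j).toCircle).measurePreserving

theorem monomialFn_rotate {d : ℕ} (α : Fin d → ℕ) (θ : UnitAddTorus (Fin d)) (w : Cd d) :
    monomialFn α (rotate θ w) =
      monomialFn α w * UnitAddTorus.mFourier (fun j => (α j : ℤ)) θ := by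
  simp only [monomialFn, rotate, mul_pow, Finset.prod_mul_distrib, UnitAddTorus.mFourier,
    ContinuousMap.coe_mk, fourier_apply]
  simp [AddCircle.toCircle_nsmul]
  ring

theorem lintegral_enorm_sq_rotate {d : ℕ} {F : Cd d → ℂ} (hF : Differentiable ℂ F) (w : Cd d) :
    ∫⁻ θ, ‖F (rotate θ w)‖ₑ ^ 2 ∂torusMeasure d =
      ∑' α : Fin d → ℕ, ‖taylorCoeff F α‖ₑ ^ 2 * ‖monomialFn α w‖ₑ ^ 2 := by
  rw [lintegral_enorm_sq_tsum_mFourier (hasSum_taylorCoeff hF w).summable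
    (f := fun θ => F (rotate θ w)) fun θ => ?_]
  · simp [mul_pow]
  · simpa only [mul_assoc, monomialFn_rotate] using hasSum_taylorCoeff hF (rotate θ w)

theorem continuous_monomialFn {d : ℕ} (α : Fin d → ℕ) : Continuous (monomialFn (d := d) α) := by
  unfold monomialFn
  fun_prop

/-- **Parseval's identity** for entire functions and rotation invariant weights. -/
theorem lintegral_enorm_sq_mul_weight {d : ℕ} {F : Cd d → ℂ} (hF : Differentiable ℂ F)
    {ρ : Cd d → ENNReal} (hρ : Measurable ρ) (hinv : ∀ θ w, ρ (rotate θ w) = ρ w) :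
    ∫⁻ w, ‖F w‖ₑ ^ 2 * ρ w =
      ∑' α : Fin d → ℕ, ‖taylorCoeff F α‖ₑ ^ 2 * ∫⁻ w, ‖monomialFn α w‖ₑ ^ 2 * ρ w := by
  have hFm : Measurable (fun w => ‖F w‖ₑ ^ 2) := hF.continuous.measurable.enorm.pow_const 2
  have hrot : ∀ θ : UnitAddTorus (Fin d),
      ∫⁻ w, ‖F (rotate θ w)‖ₑ ^ 2 * ρ w = ∫⁻ w, ‖F w‖ₑ ^ 2 * ρ w := by
    intro θ
    have h := (measurePreserving_rotate θ).lintegral_comp (hFm.mul hρ)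
    simpa only [Pi.mul_apply, hinv] using h
  -- The torus has mass one and every rotation preserves the integral, so one may average over
  -- rotations. After Tonelli, the inner integral is Parseval's identity on the torus through w.
  calc ∫⁻ w, ‖F w‖ₑ ^ 2 * ρ w
      = ∫⁻ _, (∫⁻ w, ‖F w‖ₑ ^ 2 * ρ w) ∂torusMeasure d := by simp
    _ = ∫⁻ θ, (∫⁻ w, ‖F (rotate θ w)‖ₑ ^ 2 * ρ w) ∂torusMeasure d := by simp only [hrot]
    _ = ∫⁻ w, ∫⁻ θ, ‖F (rotate θ w)‖ₑ ^ 2 * ρ w ∂torusMeasure d := by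
      refine lintegral_lintegral_swap (Measurable.aemeasurable ?_)
      exact (hFm.comp continuous_rotate.measurable).mul (hρ.comp measurable_snd)
    _ = ∫⁻ w, ∑' α : Fin d → ℕ, ‖taylorCoeff F α‖ₑ ^ 2 * (‖monomialFn α w‖ₑ ^ 2 * ρ w) := by
      refine lintegral_congr fun w => ?_
      rw [lintegral_mul_const, lintegral_enorm_sq_rotate hF, ← ENNReal.tsum_mul_right]
      · simp only [mul_assoc]
      · exact hFm.comp (continuous_rotate.measurable.comp measurable_prodMk_right)
    _ = _ := by
      rw [lintegral_tsum fun α => ?_]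
      · refine tsum_congr fun α => ?_
        rw [lintegral_const_mul]
        exact ((continuous_monomialFn α).measurable.enorm.pow_const 2).mul hρ
      · exact (((((continuous_monomialFn α).measurable.enorm.pow_const 2).mul
          hρ)).const_mul _).aemeasurable

/-! ### Weighted norms of monomials -/

/-- The square of the Euclidean length on `ℂ^d`. -/
def sqNorm {d : ℕ} (z : Cd d) : ℝ := ∑ j, ‖z j‖ ^ 2

theorem sqNorm_nonneg {d : ℕ} (z : Cd d) : 0 ≤ sqNorm z :=
  Finset.sum_nonneg fun _ _ => by positivity

theorem continuous_sqNorm {d : ℕ} : Continuous (sqNorm (d := d)) := by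
  unfold sqNorm
  fun_prop

theorem sqNorm_rotate {d : ℕ} (θ : UnitAddTorus (Fin d)) (z : Cd d) :
    sqNorm (rotate θ z) = sqNorm z := by
  simp only [sqNorm, norm_rotate_apply]

theorem norm_monomialFn_sq {d : ℕ} (α : Fin d → ℕ) (z : Cd d) :
    ‖monomialFn α z‖ ^ 2 = ∏ j, ‖z j‖ ^ (2 * α j) / (α j).factorial := by
  rw [monomialFn, norm_div, div_pow, norm_prod, Complex.norm_real, Real.norm_of_nonneg
    (Real.sqrt_nonneg _), Real.sq_sqrt (by positivity), Finset.prod_div_distrib,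
    ← Finset.prod_pow]
  congr 1
  · refine Finset.prod_congr rfl fun j _ => ?_
    rw [norm_pow, ← pow_mul, mul_comm]
  · simp [multiFactorial]

theorem integral_norm_pow_mul_exp (k : ℕ) {b : ℝ} (hb : 0 < b) :
    ∫ z : ℂ, ‖z‖ ^ (2 * k) / k.factorial * Real.exp (-b * ‖z‖ ^ 2) =
      Real.pi * b⁻¹ ^ (k + 1) := by
  have h := Complex.integral_rpow_mul_exp_neg_mul_rpow (p := 2) (q := ((2 * k : ℕ) : ℝ))
    one_le_two (by have : (0 : ℝ) ≤ ((2 * k : ℕ) : ℝ) := by positivity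
                   linarith) hb
  have h2 : (((2 * k : ℕ) : ℝ) + 2) / 2 = ((k + 1 : ℕ) : ℝ) := by push_cast; ring
  have h3 : -(((2 * k : ℕ) : ℝ) + 2) / 2 = -((k + 1 : ℕ) : ℝ) := by push_cast; ring
  rw [h2, h3, Real.rpow_neg hb.le, Real.rpow_natCast, Nat.cast_succ, Real.Gamma_nat_eq_factorial]
    at h
  simp only [Real.rpow_natCast, Real.rpow_ofNat] at h
  have h4 : ∀ z : ℂ, ‖z‖ ^ (2 * k) / k.factorial * Real.exp (-b * ‖z‖ ^ 2) =
      (k.factorial : ℝ)⁻¹ * (‖z‖ ^ (2 * k) * Real.exp (-b * ‖z‖ ^ 2)) := fun z => by ring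
  simp only [h4]
  rw [integral_const_mul, h, inv_pow]
  have : (k.factorial : ℝ) ≠ 0 := by positivity
  field_simp

theorem lintegral_norm_monomialFn_sq_mul_exp {d : ℕ} (α : Fin d → ℕ) {b : ℝ} (hb : 0 < b) :
    ∫⁻ z : Cd d, ‖monomialFn α z‖ₑ ^ 2 * ENNReal.ofReal (Real.exp (-b * sqNorm z)) =
      ENNReal.ofReal (Real.pi ^ d * b⁻¹ ^ ((∑ j, α j) + d)) := by
  have hint : ∫ z : Cd d, ∏ j, (‖z j‖ ^ (2 * α j) / (α j).factorial *
      Real.exp (-b * ‖z j‖ ^ 2)) = Real.pi ^ d * b⁻¹ ^ ((∑ j, α j) + d) := by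
    rw [integral_fintype_prod_volume_eq_prod (fun j (z : ℂ) => ‖z‖ ^ (2 * α j) /
      (α j).factorial * Real.exp (-b * ‖z‖ ^ 2))]
    simp only [integral_norm_pow_mul_exp _ hb, Finset.prod_mul_distrib, Finset.prod_const,
      Finset.card_univ, Fintype.card_fin, Finset.prod_pow_eq_pow_sum, Finset.sum_add_distrib,
      Finset.sum_const, smul_eq_mul, mul_one]
  rw [← hint, ofReal_integral_eq_lintegral_ofReal]
  · refine lintegral_congr fun z => ?_
    rw [Finset.prod_mul_distrib, ← norm_monomialFn_sq, ← Real.exp_sum, ← Finset.mul_sum,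
      ENNReal.ofReal_mul (by positivity), ENNReal.ofReal_pow (norm_nonneg _), ofReal_norm]
    rfl
  -- The integral of a nonintegrable function is 0 by convention, whereas this one has just been
  -- computed to be positive.
  · refine Integrable.of_integral_ne_zero ?_
    rw [hint]
    positivity
  · exact Filter.Eventually.of_forall fun z => Finset.prod_nonneg fun j _ => by positivity

/-- The squared norm of the normalised monomial of degree `α` for the weight
`exp (-|z|²) (1 + 2 |z|²) ^ k`. -/
def moment {d : ℕ} (k : ℤ) (α : Fin d → ℕ) : ENNReal :=
  ∫⁻ z : Cd d, ‖monomialFn α z‖ₑ ^ 2 *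
    ENNReal.ofReal (Real.exp (-sqNorm z) * (1 + 2 * sqNorm z) ^ k)

theorem one_le_japanese {d : ℕ} (α : Fin d → ℕ) : 1 ≤ japanese α :=
  Real.one_le_sqrt.2 (by nlinarith [sq_nonneg ((∑ j, α j : ℕ) : ℝ)])

theorem le_japanese {d : ℕ} (α : Fin d → ℕ) : ((∑ j, α j : ℕ) : ℝ) ≤ japanese α :=
  Real.le_sqrt_of_sq_le (by linarith)

theorem japanese_le {d : ℕ} (α : Fin d → ℕ) : japanese α ≤ ((∑ j, α j : ℕ) : ℝ) + 1 := by
  have : (0 : ℝ) ≤ ((∑ j, α j : ℕ) : ℝ) := by positivity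
  exact Real.sqrt_le_iff.2 ⟨by linarith, by nlinarith⟩

theorem measurable_monomialFn_sq {d : ℕ} (α : Fin d → ℕ) :
    Measurable (fun z : Cd d => ‖monomialFn α z‖ₑ ^ 2) :=
  (continuous_monomialFn α).measurable.enorm.pow_const 2

theorem measurable_monomialFn_sq_mul {d : ℕ} (α : Fin d → ℕ) {g : Cd d → ENNReal}
    (hg : Measurable g) : Measurable (fun z : Cd d => ‖monomialFn α z‖ₑ ^ 2 * g z) :=
  (measurable_monomialFn_sq α).mul hg

theorem measurable_ofReal_exp {d : ℕ} (b : ℝ) :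
    Measurable (fun z : Cd d => ENNReal.ofReal (Real.exp (-b * sqNorm z))) :=
  (Real.measurable_exp.comp (continuous_sqNorm.measurable.const_mul _)).ennreal_ofReal

theorem measurable_weight {d : ℕ} (k : ℤ) : Measurable (fun z : Cd d =>
    ENNReal.ofReal (Real.exp (-sqNorm z) * (1 + 2 * sqNorm z) ^ k)) := by
  have h := (continuous_sqNorm (d := d)).measurable
  exact ((Real.measurable_exp.comp h.neg).mul
    (((h.const_mul 2).const_add 1).pow_const k)).ennreal_ofReal

/-- With l = ⟨α⟩, the factor (1 + 2t)^k is at most a constant times l^k e^{t/(2l)}, so the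
polynomial weight costs only a weakening of the Gaussian exponent from 1 to b = 1 - 1/(2l). The
exact integral then gains b^{-(|α|+d)} ≤ e^{(|α|+d)/l} ≤ e^{1+d}, because |α| ≤ l and 1 ≤ l. -/
theorem moment_natCast_le (d k : ℕ) : ∃ C : ℝ, 0 < C ∧ ∀ α : Fin d → ℕ,
    moment (k : ℤ) α ≤ ENNReal.ofReal (C * japanese α ^ (k : ℤ)) := by
  refine ⟨4 ^ k * k.factorial * Real.exp 1 * (Real.pi ^ d * Real.exp (1 + d)), by positivity,
    fun α => ?_⟩
  set l := japanese α
  have hl : 1 ≤ l := one_le_japanese α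
  have hl0 : 0 < l := by linarith
  have hb : 0 < 1 - 1 / (2 * l) := by
    rw [sub_pos, div_lt_one (by positivity)]
    linarith
  set K : ℝ := 4 ^ k * k.factorial * Real.exp 1 * l ^ k with hK
  have hpt : ∀ z : Cd d, Real.exp (-sqNorm z) * (1 + 2 * sqNorm z) ^ (k : ℤ) ≤
      K * Real.exp (-(1 - 1 / (2 * l)) * sqNorm z) := by
    intro z
    have ht := sqNorm_nonneg z
    set t := sqNorm z
    have h1 := Real.pow_div_factorial_le_exp ((1 + 2 * t) / (4 * l)) (by positivity) k
    rw [div_le_iff₀ (by positivity), div_pow, div_le_iff₀ (by positivity)] at h1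
    have h2 : Real.exp ((1 + 2 * t) / (4 * l)) ≤ Real.exp 1 * Real.exp (t / (2 * l)) := by
      rw [← Real.exp_add]
      apply Real.exp_le_exp.2
      have : (1 + 2 * t) / (4 * l) = 1 / (4 * l) + t / (2 * l) := by field_simp; ring
      rw [this]
      gcongr
      rw [div_le_one (by positivity)]
      linarith
    rw [zpow_natCast]
    calc Real.exp (-t) * (1 + 2 * t) ^ k
        ≤ Real.exp (-t) * ((Real.exp 1 * Real.exp (t / (2 * l))) * k.factorial * (4 * l) ^ k) := by
          gcongr
          exact h1.trans (by gcongr)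
      _ = K * (Real.exp (-t) * Real.exp (t / (2 * l))) := by rw [hK, mul_pow]; ring
      _ = _ := by
          rw [← Real.exp_add]
          congr 2
          field_simp
          ring
  calc moment (k : ℤ) α
      ≤ ∫⁻ z : Cd d, ENNReal.ofReal K * (‖monomialFn α z‖ₑ ^ 2 *
          ENNReal.ofReal (Real.exp (-(1 - 1 / (2 * l)) * sqNorm z))) := by
        refine lintegral_mono fun z => ?_
        rw [mul_left_comm, ← ENNReal.ofReal_mul (by positivity)]
        exact mul_le_mul_right (ENNReal.ofReal_le_ofReal (hpt z)) _
    _ = ENNReal.ofReal (K * (Real.pi ^ d * (1 - 1 / (2 * l))⁻¹ ^ ((∑ j, α j) + d))) := by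
        rw [lintegral_const_mul _ (measurable_monomialFn_sq_mul α (measurable_ofReal_exp _)),
          lintegral_norm_monomialFn_sq_mul_exp α hb, ← ENNReal.ofReal_mul (by positivity)]
    _ ≤ _ := by
        apply ENNReal.ofReal_le_ofReal
        have h1 : (1 - 1 / (2 * l))⁻¹ ≤ Real.exp (1 / l) := by
          refine le_trans ?_ (Real.add_one_le_exp (1 / l))
          rw [inv_le_iff_one_le_mul₀ hb]
          have hm : 0 ≤ 1 / l ∧ 1 / l ≤ 1 := ⟨by positivity, by rw [div_le_one hl0]; exact hl⟩
          have : 1 / (2 * l) = (1 / l) / 2 := by field_simp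
          rw [this]
          nlinarith
        have h2 : (1 - 1 / (2 * l))⁻¹ ^ ((∑ j, α j) + d) ≤ Real.exp (1 + d) := by
          refine (pow_le_pow_left₀ (by positivity) h1 _).trans ?_
          rw [← Real.exp_nat_mul]
          apply Real.exp_le_exp.2
          rw [mul_one_div, div_le_iff₀ hl0]
          push_cast
          have h3 := le_japanese α
          push_cast at h3
          have h4 : (d : ℝ) ≤ d * l := le_mul_of_one_le_right (by positivity) hl
          linarith
        rw [zpow_natCast]
        calc K * (Real.pi ^ d * (1 - 1 / (2 * l))⁻¹ ^ ((∑ j, α j) + d))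
            ≤ K * (Real.pi ^ d * Real.exp (1 + d)) := by gcongr
          _ = _ := by rw [hK]; ring

/-- Since √e < 2, the geometric factor beats the polynomial. This absorbs the region near the origin
in `moment_neg_natCast_le`. -/
theorem exists_exp_half_mul_le (k : ℕ) : ∃ C : ℝ, 0 < C ∧ ∀ n : ℕ,
    Real.exp (((n : ℝ) + 1) / 2) * (2 : ℝ)⁻¹ ^ n * ((n : ℝ) + 1) ^ k ≤ C := by
  have h1 : Real.exp (1 / 2) / 2 < 1 := by
    rw [div_lt_one two_pos, ← Real.lt_log_iff_exp_lt two_pos]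
    linarith [Real.log_two_gt_d9]
  have h := tendsto_pow_const_mul_const_pow_of_abs_lt_one k (r := Real.exp (1 / 2) / 2)
    (by rwa [abs_of_pos (by positivity)])
  obtain ⟨C, hC⟩ := h.bddAbove_range
  refine ⟨2 * (|C| + 1), by positivity, fun n => ?_⟩
  have h2 := hC ⟨n + 1, rfl⟩
  simp only [div_pow, ← Real.exp_nat_mul] at h2
  push_cast at h2
  calc Real.exp (((n : ℝ) + 1) / 2) * (2 : ℝ)⁻¹ ^ n * ((n : ℝ) + 1) ^ k
      = 2 * (((n : ℝ) + 1) ^ k * (Real.exp (((n : ℝ) + 1) * (1 / 2)) / 2 ^ (n + 1))) := by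
        rw [mul_one_div, pow_succ, inv_pow]
        field_simp
    _ ≤ _ := by gcongr; linarith [le_abs_self C]

/-- Split at 1 + 2|z|² = l, where l = ⟨α⟩. Outside, the weight is at most l^{-k}. Inside, |z|² <
l/2, so e^{-|z|²} ≤ e^{l/2} e^{-2|z|²}; the doubled Gaussian contributes 2^{-(|α|+d)}, which
outweighs e^{l/2} because l ≤ |α| + 1. -/
theorem moment_neg_natCast_le (d k : ℕ) : ∃ C : ℝ, 0 < C ∧ ∀ α : Fin d → ℕ,
    moment (-(k : ℤ)) α ≤ ENNReal.ofReal (C * japanese α ^ (-(k : ℤ))) := by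
  obtain ⟨C, hC0, hC⟩ := exists_exp_half_mul_le k
  refine ⟨Real.pi ^ d * (1 + C), by positivity, fun α => ?_⟩
  set l := japanese α
  have hl : 1 ≤ l := one_le_japanese α
  have hl0 : 0 < l := by linarith
  have hpt : ∀ z : Cd d, Real.exp (-sqNorm z) * (1 + 2 * sqNorm z) ^ (-(k : ℤ)) ≤
      l ^ (-(k : ℤ)) * Real.exp (-1 * sqNorm z) +
        Real.exp (l / 2) * Real.exp (-2 * sqNorm z) := by
    intro z
    have ht := sqNorm_nonneg z
    set t := sqNorm z
    simp only [zpow_neg, zpow_natCast]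
    rcases le_or_gt l (1 + 2 * t) with h | h
    · have : Real.exp (-t) * ((1 + 2 * t) ^ k)⁻¹ ≤ (l ^ k)⁻¹ * Real.exp (-1 * t) := by
        rw [mul_comm, neg_one_mul]
        gcongr
      have h2 : 0 ≤ Real.exp (l / 2) * Real.exp (-2 * t) := by positivity
      linarith
    · have h1 : Real.exp (-t) * ((1 + 2 * t) ^ k)⁻¹ ≤ Real.exp (l / 2) * Real.exp (-2 * t) := by
        refine (mul_le_of_le_one_right (by positivity)
          (inv_le_one_of_one_le₀ (one_le_pow₀ (by linarith)))).trans ?_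
        rw [← Real.exp_add]
        apply Real.exp_le_exp.2
        linarith
      have h2 : 0 ≤ (l ^ k)⁻¹ * Real.exp (-1 * t) := by positivity
      linarith
  have hm := fun b => measurable_monomialFn_sq_mul α (measurable_ofReal_exp (d := d) b)
  calc moment (-(k : ℤ)) α
      ≤ ∫⁻ z : Cd d, (ENNReal.ofReal (l ^ (-(k : ℤ))) * (‖monomialFn α z‖ₑ ^ 2 *
          ENNReal.ofReal (Real.exp (-1 * sqNorm z))) +
          ENNReal.ofReal (Real.exp (l / 2)) * (‖monomialFn α z‖ₑ ^ 2 *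
          ENNReal.ofReal (Real.exp (-2 * sqNorm z)))) := by
        refine lintegral_mono fun z => ?_
        rw [mul_left_comm, mul_left_comm (ENNReal.ofReal (Real.exp _)), ← mul_add,
          ← ENNReal.ofReal_mul (by positivity), ← ENNReal.ofReal_mul (by positivity),
          ← ENNReal.ofReal_add (by positivity) (by positivity)]
        gcongr
        exact hpt z
    _ = ENNReal.ofReal (l ^ (-(k : ℤ)) * (Real.pi ^ d * (1 : ℝ)⁻¹ ^ ((∑ j, α j) + d)) +
          Real.exp (l / 2) * (Real.pi ^ d * (2 : ℝ)⁻¹ ^ ((∑ j, α j) + d))) := by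
        rw [lintegral_add_left ((hm 1).const_mul _), lintegral_const_mul _ (hm 1),
          lintegral_const_mul _ (hm 2), lintegral_norm_monomialFn_sq_mul_exp α one_pos,
          lintegral_norm_monomialFn_sq_mul_exp α two_pos, ← ENNReal.ofReal_mul (by positivity),
          ← ENNReal.ofReal_mul (by positivity), ← ENNReal.ofReal_add (by positivity)
          (by positivity)]
    _ ≤ _ := by
        apply ENNReal.ofReal_le_ofReal
        have h1 : Real.exp (l / 2) * (2 : ℝ)⁻¹ ^ ((∑ j, α j) + d) ≤ C * l ^ (-(k : ℤ)) := by
          rw [zpow_neg, zpow_natCast, ← div_eq_mul_inv, le_div_iff₀ (by positivity)]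
          refine le_trans ?_ (hC (∑ j, α j))
          have h2 := japanese_le α
          gcongr ?_ * ?_ * ?_
          · exact Real.exp_le_exp.2 (by linarith)
          · exact pow_le_pow_of_le_one (by norm_num) (by norm_num) (by omega)
          · exact pow_le_pow_left₀ hl0.le h2 k
        have hp : 0 ≤ Real.pi ^ d := by positivity
        rw [inv_one, one_pow]
        calc _ = Real.pi ^ d * (l ^ (-(k : ℤ)) +
              Real.exp (l / 2) * (2 : ℝ)⁻¹ ^ ((∑ j, α j) + d)) := by ring
          _ ≤ Real.pi ^ d * (l ^ (-(k : ℤ)) + C * l ^ (-(k : ℤ))) := by gcongr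
          _ = _ := by ring

theorem moment_le (d : ℕ) (k : ℤ) : ∃ C : ℝ, 0 < C ∧ ∀ α : Fin d → ℕ,
    moment k α ≤ ENNReal.ofReal (C * japanese α ^ k) := by
  obtain ⟨n, rfl | rfl⟩ := k.eq_nat_or_neg
  · exact moment_natCast_le d n
  · exact moment_neg_natCast_le d n

/-- The lower bound follows by duality from the upper bound for -k: as 1 ≤ g + g⁻¹ for g = a(1 +
2|z|²)^k, the Gaussian mass P = π^d is at most a times the moment of order k plus a⁻¹ times the
moment of order -k. -/
theorem le_moment (d : ℕ) (k : ℤ) : ∃ c : ℝ, 0 < c ∧ ∀ α : Fin d → ℕ,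
    ENNReal.ofReal (c * japanese α ^ k) ≤ moment k α := by
  obtain ⟨C, hC0, hC⟩ := moment_le d (-k)
  set P : ℝ := Real.pi ^ d with hP
  have hP0 : 0 < P := by positivity
  refine ⟨P ^ 2 / (4 * C), by positivity, fun α => ?_⟩
  have hl0 : 0 < japanese α := by linarith [one_le_japanese α]
  set l := japanese α
  -- Chosen so that the term with the moment of order -k is at most P/2 and can be absorbed.
  set a : ℝ := 2 * C * l ^ (-k) / P with ha
  have ha0 : 0 < a := by positivity
  have hpt : ∀ z : Cd d, Real.exp (-1 * sqNorm z) ≤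
      a * (Real.exp (-sqNorm z) * (1 + 2 * sqNorm z) ^ k) +
        a⁻¹ * (Real.exp (-sqNorm z) * (1 + 2 * sqNorm z) ^ (-k)) := by
    intro z
    have ht := sqNorm_nonneg z
    have hg : 0 < a * (1 + 2 * sqNorm z) ^ k := by positivity
    have h1 : 1 ≤ a * (1 + 2 * sqNorm z) ^ k + (a * (1 + 2 * sqNorm z) ^ k)⁻¹ := by
      rcases le_or_gt 1 (a * (1 + 2 * sqNorm z) ^ k) with h | h
      · linarith [inv_pos.2 hg]
      · linarith [(one_lt_inv₀ hg).2 h]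
    calc Real.exp (-1 * sqNorm z) = Real.exp (-sqNorm z) * 1 := by ring_nf
      _ ≤ Real.exp (-sqNorm z) *
          (a * (1 + 2 * sqNorm z) ^ k + (a * (1 + 2 * sqNorm z) ^ k)⁻¹) := by gcongr
      _ = _ := by rw [mul_inv, zpow_neg]; ring
  have hm := fun k => measurable_monomialFn_sq_mul α (measurable_weight (d := d) k)
  have h1 : ENNReal.ofReal P ≤ ENNReal.ofReal a * moment k α +
      ENNReal.ofReal a⁻¹ * moment (-k) α := by
    have h0 := lintegral_norm_monomialFn_sq_mul_exp α one_pos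
    rw [inv_one, one_pow, mul_one] at h0
    rw [hP, ← h0, moment, moment, ← lintegral_const_mul _ (hm k), ← lintegral_const_mul _ (hm (-k)),
      ← lintegral_add_left ((hm k).const_mul _)]
    refine lintegral_mono fun z => ?_
    have ht := sqNorm_nonneg z
    rw [mul_left_comm, mul_left_comm (ENNReal.ofReal a⁻¹), ← mul_add,
      ← ENNReal.ofReal_mul (by positivity), ← ENNReal.ofReal_mul (by positivity),
      ← ENNReal.ofReal_add (by positivity) (by positivity)]
    gcongr
    exact hpt z
  have h2 : ENNReal.ofReal a⁻¹ * moment (-k) α ≤ ENNReal.ofReal (P / 2) := by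
    refine (mul_le_mul_right (hC α) _).trans ?_
    rw [← ENNReal.ofReal_mul (by positivity)]
    apply ENNReal.ofReal_le_ofReal
    have hl' : l ^ (-k) ≠ 0 := by positivity
    change a⁻¹ * (C * l ^ (-k)) ≤ P / 2
    rw [ha]
    apply le_of_eq
    field_simp
  have h3 : ENNReal.ofReal (P / 2) ≤ ENNReal.ofReal a * moment k α := by
    have h4 : ENNReal.ofReal P = ENNReal.ofReal (P / 2) + ENNReal.ofReal (P / 2) := by
      rw [← ENNReal.ofReal_add (by positivity) (by positivity), add_halves]
    rw [h4] at h1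
    exact (ENNReal.add_le_add_iff_right ENNReal.ofReal_ne_top).1 (h1.trans (by gcongr))
  have h5 : P ^ 2 / (4 * C) * l ^ k = a⁻¹ * (P / 2) := by
    rw [ha, zpow_neg]
    field_simp
    ring
  rw [h5, ENNReal.ofReal_mul (by positivity)]
  refine (mul_le_mul_right h3 _).trans_eq ?_
  rw [← mul_assoc, ← ENNReal.ofReal_mul (by positivity), inv_mul_cancel₀ ha0.ne',
    ENNReal.ofReal_one, one_mul]

/-! ### Transfer from phase space to `ℂ^d` -/

/-- The identification `(x, ξ) ↦ 2^{-1/2} (x - i ξ)` of `ℝ^{2d}` with `ℂ^d`. -/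
def phase {d : ℕ} (p : Rd d × Rd d) : Cd d := fun j =>
  (((Real.sqrt 2)⁻¹ * p.1 j : ℝ) : ℂ) + Complex.I * ((-(Real.sqrt 2)⁻¹ * p.2 j : ℝ) : ℂ)

/-- `phase` as a real-linear equivalence. -/
def phaseEquiv (d : ℕ) : (Rd d × Rd d) ≃ₗ[ℝ] Cd d where
  toFun := phase
  map_add' p q := by
    funext j
    simp [phase]
    ring
  map_smul' c p := by
    funext j
    simp [phase]
    ring
  invFun z := (WithLp.toLp 2 fun j => Real.sqrt 2 * (z j).re,
    WithLp.toLp 2 fun j => -Real.sqrt 2 * (z j).im)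
  left_inv p := by
    have h2 : Real.sqrt 2 * (Real.sqrt 2)⁻¹ = 1 := mul_inv_cancel₀ (by simp)
    ext j
    · have : (phase p j).re = (Real.sqrt 2)⁻¹ * p.1 j := by
        simp only [phase, Complex.add_re, Complex.ofReal_re, Complex.mul_re,
          Complex.I_re, Complex.I_im, Complex.ofReal_im]
        ring
      change Real.sqrt 2 * (phase p j).re = p.1 j
      rw [this, ← mul_assoc, h2, one_mul]
    · have : (phase p j).im = -((Real.sqrt 2)⁻¹ * p.2 j) := by
        simp only [phase, Complex.add_im, Complex.ofReal_re, Complex.mul_im,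
          Complex.I_re, Complex.I_im, Complex.ofReal_im]
        ring
      change -Real.sqrt 2 * (phase p j).im = p.2 j
      rw [this, neg_mul_neg, ← mul_assoc, h2, one_mul]
  right_inv z := by
    funext j
    apply Complex.ext <;> simp [phase]

theorem continuous_phase {d : ℕ} : Continuous (phase (d := d)) :=
  (phaseEquiv d).toContinuousLinearEquiv.continuous

/-- A linear isomorphism carries Haar measure to Haar measure. The Jacobian itself is irrelevant;
only its being nonzero and finite matters. -/
theorem map_phase_volume (d : ℕ) : ∃ c : ENNReal, c ≠ 0 ∧ c ≠ ⊤ ∧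
    (volume : Measure (Rd d × Rd d)).map phase = c • (volume : Measure (Cd d)) := by
  have h0 : (volume : Measure (Rd d × Rd d)).IsAddHaarMeasure :=
    inferInstanceAs ((volume : Measure (Rd d)).prod (volume : Measure (Rd d))).IsAddHaarMeasure
  have h : ((volume : Measure (Rd d × Rd d)).map
      ((phaseEquiv d).toContinuousLinearEquiv)).IsAddHaarMeasure :=
    (phaseEquiv d).toContinuousLinearEquiv.isAddHaarMeasure_map volume
  have h2 := Measure.isAddLeftInvariant_eq_smul ((volume : Measure (Rd d × Rd d)).map
      ((phaseEquiv d).toContinuousLinearEquiv)) (volume : Measure (Cd d))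
  refine ⟨_, ?_, ENNReal.coe_ne_top, h2⟩
  intro h0
  rw [ENNReal.coe_eq_zero] at h0
  rw [h0, zero_smul] at h2
  exact h.toIsOpenPosMeasure.open_pos Set.univ isOpen_univ Set.univ_nonempty (by rw [h2]; simp)

theorem sqNorm_phase {d : ℕ} (p : Rd d × Rd d) :
    2 * sqNorm (phase p) = ‖p.1‖ ^ 2 + ‖p.2‖ ^ 2 := by
  rw [EuclideanSpace.norm_sq_eq, EuclideanSpace.norm_sq_eq, ← Finset.sum_add_distrib, sqNorm,
    Finset.mul_sum]
  refine Finset.sum_congr rfl fun j _ => ?_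
  rw [phase, ← Complex.normSq_eq_norm_sq, mul_comm Complex.I, Complex.normSq_add_mul_I]
  rw [Real.norm_eq_abs, Real.norm_eq_abs, sq_abs, sq_abs, mul_pow, mul_pow, neg_sq, inv_pow,
    Real.sq_sqrt zero_le_two]
  ring

theorem dilatedGauss_eq {d : ℕ} (F : Cd d → ℂ) (p : Rd d × Rd d) :
    dilatedGauss F p = F (phase p) * ((Real.exp (-sqNorm (phase p) / 2) : ℝ) : ℂ) := rfl

theorem sigma_eq {d : ℕ} (N : ℤ) (p : Rd d × Rd d) :
    sigma (2 * (N : ℝ)) p = (1 + 2 * sqNorm (phase p)) ^ N := by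
  rw [sigma, sqNorm_phase, ← add_assoc, mul_div_cancel_left₀ _ two_ne_zero, Real.rpow_intCast]

/-- The squared norm of `A(σ_{2N}, L²)`, with values in `[0, ∞]`. -/
def energy {d : ℕ} (N : ℤ) (F : Cd d → ℂ) : ENNReal :=
  ∫⁻ p, ‖dilatedGauss F p * (sigma (2 * (N : ℝ)) p : ℂ)‖ₑ ^ 2

theorem enorm_dilatedGauss_mul_sigma {d : ℕ} (N : ℤ) (F : Cd d → ℂ) (p : Rd d × Rd d) :
    ‖dilatedGauss F p * (sigma (2 * (N : ℝ)) p : ℂ)‖ₑ ^ 2 = ‖F (phase p)‖ₑ ^ 2 *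
      ENNReal.ofReal (Real.exp (-sqNorm (phase p)) * (1 + 2 * sqNorm (phase p)) ^ (2 * N)) := by
  have ht := sqNorm_nonneg (phase p)
  rw [dilatedGauss_eq, sigma_eq, ← ofReal_norm, ← ofReal_norm, ← ENNReal.ofReal_pow (norm_nonneg _),
    ← ENNReal.ofReal_pow (norm_nonneg _), ← ENNReal.ofReal_mul (by positivity)]
  congr 1
  have hz : 0 ≤ (1 + 2 * sqNorm (phase p)) ^ N := by positivity
  rw [norm_mul, norm_mul, Complex.norm_real, Complex.norm_real, Real.norm_of_nonneg
    (Real.exp_nonneg _), Real.norm_of_nonneg hz, mul_pow, mul_pow, ← Real.exp_nat_mul,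
    mul_comm 2 N, zpow_mul, zpow_ofNat, mul_assoc]
  congr 3
  push_cast
  ring

/-- Parseval's identity combined with the two-sided moment bounds. Stated in [0, ∞] without any
finiteness assumption, it yields both the membership criterion and the norm equivalence. -/
theorem energy_bounds (d : ℕ) (N : ℤ) : ∃ c C : ℝ, 0 < c ∧ 0 < C ∧
    ∀ F : Cd d → ℂ, Differentiable ℂ F →
      ENNReal.ofReal c * ∑' α, ENNReal.ofReal (coeffTerm N F α) ≤ energy N F ∧
      energy N F ≤ ENNReal.ofReal C * ∑' α, ENNReal.ofReal (coeffTerm N F α) := by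
  obtain ⟨c₁, hc₁, hl⟩ := le_moment d (2 * N)
  obtain ⟨C₁, hC₁, hu⟩ := moment_le d (2 * N)
  obtain ⟨κ, hκ0, hκt, hmap⟩ := map_phase_volume d
  have hκ : 0 < κ.toReal := ENNReal.toReal_pos hκ0 hκt
  refine ⟨κ.toReal * c₁, κ.toReal * C₁, by positivity, by positivity, fun F hF => ?_⟩
  have hE : energy N F = κ * ∑' α : Fin d → ℕ, ‖taylorCoeff F α‖ₑ ^ 2 * moment (2 * N) α := by
    have hm : Measurable (fun z => ‖F z‖ₑ ^ 2 *
        ENNReal.ofReal (Real.exp (-sqNorm z) * (1 + 2 * sqNorm z) ^ (2 * N))) :=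
      (hF.continuous.measurable.enorm.pow_const 2).mul (measurable_weight _)
    have h1 := lintegral_map (μ := volume) hm (continuous_phase (d := d)).measurable
    rw [hmap, lintegral_smul_measure, lintegral_enorm_sq_mul_weight hF (measurable_weight _)
      (fun θ w => by simp only [sqNorm_rotate])] at h1
    simp only [energy, enorm_dilatedGauss_mul_sigma]
    exact h1.symm
  have hterm : ∀ (b : ℝ), 0 < b → ∀ α : Fin d → ℕ,
      ‖taylorCoeff F α‖ₑ ^ 2 * ENNReal.ofReal (b * japanese α ^ (2 * N)) =
        ENNReal.ofReal b * ENNReal.ofReal (coeffTerm N F α) := by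
    intro b hb α
    have : 0 < japanese α := by linarith [one_le_japanese α]
    rw [coeffTerm, ENNReal.ofReal_mul hb.le, ENNReal.ofReal_mul (by positivity),
      ENNReal.ofReal_pow (norm_nonneg _), ofReal_norm]
    ring
  rw [hE, ENNReal.ofReal_mul hκ.le, ENNReal.ofReal_mul hκ.le, ENNReal.ofReal_toReal hκt,
    mul_assoc, mul_assoc]
  constructor
  · rw [← ENNReal.tsum_mul_left (a := ENNReal.ofReal c₁)]
    refine mul_le_mul_right (ENNReal.tsum_le_tsum fun α => ?_) _
    rw [← hterm c₁ hc₁]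
    exact mul_le_mul_right (hl α) _
  · rw [← ENNReal.tsum_mul_left (a := ENNReal.ofReal C₁)]
    refine mul_le_mul_right (ENNReal.tsum_le_tsum fun α => ?_) _
    rw [← hterm C₁ hC₁]
    exact mul_le_mul_right (hu α) _

theorem coeffTerm_nonneg {d : ℕ} (N : ℤ) (F : Cd d → ℂ) (α : Fin d → ℕ) :
    0 ≤ coeffTerm N F α := by
  have : 0 < japanese α := by linarith [one_le_japanese α]
  rw [coeffTerm]
  positivity

theorem continuous_dilatedGauss {d : ℕ} {F : Cd d → ℂ} (hF : Continuous F) :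
    Continuous (dilatedGauss F) := by
  have h : Continuous (fun p : Rd d × Rd d => F (phase p) *
      ((Real.exp (-sqNorm (phase p) / 2) : ℝ) : ℂ)) :=
    (hF.comp continuous_phase).mul (Complex.continuous_ofReal.comp (Real.continuous_exp.comp
      ((continuous_sqNorm.comp continuous_phase).neg.div_const 2)))
  exact h

theorem continuous_sigma {d : ℕ} (N : ℤ) : Continuous (sigma (d := d) (2 * (N : ℝ))) := by
  rw [show sigma (d := d) (2 * (N : ℝ)) = fun p => (1 + 2 * sqNorm (phase p)) ^ N from
    funext (sigma_eq N)]
  refine Continuous.zpow₀ (by have := continuous_sqNorm.comp (continuous_phase (d := d))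
                              fun_prop) N fun p => Or.inl ?_
  have := sqNorm_nonneg (phase p)
  positivity

theorem aestronglyMeasurable_mul_sigma {d : ℕ} (N : ℤ) {g : Rd d × Rd d → ℂ}
    (hg : Continuous g) :
    AEStronglyMeasurable (fun p => g p * (sigma (2 * (N : ℝ)) p : ℂ)) volume :=
  (hg.mul (Complex.continuous_ofReal.comp (continuous_sigma N))).aestronglyMeasurable

theorem memLp_two_iff {X : Type*} [MeasurableSpace X] {μ : Measure X} {g : X → ℂ}
    (hg : AEStronglyMeasurable g μ) : MemLp g 2 μ ↔ ∫⁻ x, ‖g x‖ₑ ^ 2 ∂μ ≠ ⊤ := by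
  have h := eLpNorm_nnreal_pow_eq_lintegral (f := g) (μ := μ) (p := 2) (by norm_num)
  simp only [NNReal.coe_ofNat, ENNReal.rpow_ofNat, ENNReal.coe_ofNat] at h
  rw [← h, MemLp, and_iff_right hg, lt_top_iff_ne_top]
  simp

theorem toReal_eLpNorm_two {X : Type*} [MeasurableSpace X] {μ : Measure X} (g : X → ℂ) :
    (eLpNorm g 2 μ).toReal = Real.sqrt (∫⁻ x, ‖g x‖ₑ ^ 2 ∂μ).toReal := by
  have h := eLpNorm_nnreal_pow_eq_lintegral (f := g) (μ := μ) (p := 2) (by norm_num)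
  simp only [NNReal.coe_ofNat, ENNReal.rpow_ofNat, ENNReal.coe_ofNat] at h
  rw [← h, ENNReal.toReal_pow, Real.sqrt_sq ENNReal.toReal_nonneg]

theorem memLp_dilatedGauss_iff {d : ℕ} (N : ℤ) {F : Cd d → ℂ} (hF : Differentiable ℂ F) :
    MemLp (fun p => dilatedGauss F p * (sigma (2 * (N : ℝ)) p : ℂ)) 2 volume ↔
      Summable (coeffTerm N F) := by
  obtain ⟨c, C, hc, hC, h⟩ := energy_bounds d N
  obtain ⟨h1, h2⟩ := h F hF
  rw [memLp_two_iff (aestronglyMeasurable_mul_sigma N (continuous_dilatedGauss hF.continuous))]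
  change energy N F ≠ ⊤ ↔ _
  have h3 : Summable (coeffTerm N F) ↔ ∑' α, ENNReal.ofReal (coeffTerm N F α) ≠ ⊤ := by
    refine ⟨fun h => h.tsum_ofReal_ne_top, fun h => ?_⟩
    have := ENNReal.summable_toReal h
    simpa only [ENNReal.toReal_ofReal (coeffTerm_nonneg N F _)] using this
  rw [h3]
  constructor
  · intro hE hS
    rw [hS, ENNReal.mul_top (by simpa using hc)] at h1
    exact hE (top_le_iff.1 h1)
  · exact fun hS => ne_top_of_le_ne_top (ENNReal.mul_ne_top ENNReal.ofReal_ne_top hS) h2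

theorem exists_coeffNorm_equiv_normA (d : ℕ) (N : ℤ) : ∃ C : ℝ, 0 < C ∧
    ∀ F : Cd d → ℂ, Differentiable ℂ F → Summable (coeffTerm N F) →
      C⁻¹ * coeffNorm N F ≤ normA (sigma (2 * (N : ℝ))) F ∧
      normA (sigma (2 * (N : ℝ))) F ≤ C * coeffNorm N F := by
  obtain ⟨c, C, hc, hC, h⟩ := energy_bounds d N
  refine ⟨max (Real.sqrt C) (Real.sqrt c)⁻¹, by positivity, fun F hF hs => ?_⟩
  obtain ⟨h1, h2⟩ := h F hF
  rw [← ENNReal.ofReal_tsum_of_nonneg (coeffTerm_nonneg N F) hs] at h1 h2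
  have hT : 0 ≤ ∑' α, coeffTerm N F α := tsum_nonneg (coeffTerm_nonneg N F)
  rw [← ENNReal.ofReal_mul hc.le] at h1
  rw [← ENNReal.ofReal_mul hC.le] at h2
  have hE : energy N F ≠ ⊤ := ne_top_of_le_ne_top ENNReal.ofReal_ne_top h2
  have h1' := (ENNReal.ofReal_le_iff_le_toReal hE).1 h1
  have h2' := ENNReal.toReal_le_of_le_ofReal (by positivity) h2
  have hn : normA (sigma (2 * (N : ℝ))) F = Real.sqrt (energy N F).toReal :=
    toReal_eLpNorm_two _
  have h3 := Real.sqrt_le_sqrt h1'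
  have h4 := Real.sqrt_le_sqrt h2'
  rw [Real.sqrt_mul hc.le] at h3
  rw [Real.sqrt_mul hC.le] at h4
  rw [hn]
  constructor
  · refine le_trans ?_ h3
    unfold coeffNorm
    gcongr
    exact inv_le_of_inv_le₀ (by positivity) (le_max_right _ _)
  · refine h4.trans ?_
    unfold coeffNorm
    gcongr
    exact le_max_left _ _

/-! ### The short-time Fourier transform and the Bargmann transform -/

/-- Both sides are multiples of the same `gaussian`, because √2 times `phase p` is x - iξ. -/
theorem stftAtom_eq_smul_bargmannKernel {d : ℕ} (p : Rd d × Rd d) :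
    stftAtom p.1 p.2 = Complex.exp (-((‖p.1‖ ^ 2 : ℝ) : ℂ) / 2 + dot (phase p) (phase p) / 2) •
      bargmannKernel (phase p) := by
  have h2 : (Real.sqrt 2 : ℂ) * ((Real.sqrt 2)⁻¹ : ℝ) = 1 := by
    rw [← Complex.ofReal_mul, mul_inv_cancel₀ (by simp), Complex.ofReal_one]
  have hw : (fun j => (Real.sqrt 2 : ℂ) * phase p j) =
      fun j => (p.1 j : ℂ) - Complex.I * (p.2 j : ℂ) := by
    funext j
    calc (Real.sqrt 2 : ℂ) * phase p j = ((Real.sqrt 2 : ℂ) * ((Real.sqrt 2)⁻¹ : ℝ)) *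
          ((p.1 j : ℂ) - Complex.I * (p.2 j : ℂ)) := by
          simp only [phase]
          push_cast
          ring
      _ = _ := by rw [h2, one_mul]
  rw [stftAtom, bargmannKernel, hw, smul_smul]
  congr 1
  rw [mul_left_comm, ← Complex.exp_add]
  push_cast
  congr 2
  ring

theorem norm_exp_phase {d : ℕ} (p : Rd d × Rd d) :
    ‖Complex.exp (-((‖p.1‖ ^ 2 : ℝ) : ℂ) / 2 + dot (phase p) (phase p) / 2)‖ =
      Real.exp (-sqNorm (phase p) / 2) := by
  have h1 : (dot (phase p) (phase p)).re = (‖p.1‖ ^ 2 - ‖p.2‖ ^ 2) / 2 := by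
    rw [EuclideanSpace.norm_sq_eq, EuclideanSpace.norm_sq_eq, ← Finset.sum_sub_distrib, dot,
      Complex.re_sum, Finset.sum_div]
    refine Finset.sum_congr rfl fun j _ => ?_
    have h2 : (Real.sqrt 2)⁻¹ * (Real.sqrt 2)⁻¹ = 1 / 2 := by
      rw [← mul_inv, Real.mul_self_sqrt zero_le_two, one_div]
    rw [Real.norm_eq_abs, Real.norm_eq_abs, sq_abs, sq_abs]
    simp only [phase, Complex.mul_re, Complex.add_re, Complex.add_im, Complex.ofReal_re,
      Complex.ofReal_im, Complex.mul_im, Complex.I_re, Complex.I_im]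
    linear_combination (p.1 j ^ 2 - p.2 j ^ 2) * h2
  have h3 := sqNorm_phase p
  rw [Complex.norm_exp]
  congr 1
  have h4 : (-((‖p.1‖ ^ 2 : ℝ) : ℂ) / 2 + dot (phase p) (phase p) / 2).re =
      -‖p.1‖ ^ 2 / 2 + (dot (phase p) (phase p)).re / 2 := by
    have : -((‖p.1‖ ^ 2 : ℝ) : ℂ) / 2 = ((-‖p.1‖ ^ 2 / 2 : ℝ) : ℂ) := by push_cast; ring
    rw [Complex.add_re, this, Complex.ofReal_re, Complex.div_ofNat_re]
  rw [h4, h1]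
  linarith

theorem norm_stft {d : ℕ} (f : 𝓢'(Rd d, ℂ)) (p : Rd d × Rd d) :
    ‖stft f p‖ = (2 * Real.pi) ^ (-(d : ℝ) / 2) * ‖dilatedGauss (bargmann f) p‖ := by
  rw [stft, stftAtom_eq_smul_bargmannKernel, map_smul, dilatedGauss_eq, norm_mul, norm_smul,
    norm_exp_phase, norm_mul, Complex.norm_real, Complex.norm_real, Real.norm_of_nonneg
    (by positivity), Real.norm_of_nonneg (by positivity), bargmann,
    mul_comm (Real.exp _)]

theorem continuous_stft {d : ℕ} {f : 𝓢'(Rd d, ℂ)} (hf : Continuous (bargmann f)) :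
    Continuous (stft f) := by
  have h : stft f = fun p => (((2 * Real.pi) ^ (-(d : ℝ) / 2) : ℝ) : ℂ) *
      (Complex.exp (-((‖p.1‖ ^ 2 : ℝ) : ℂ) / 2 + dot (phase p) (phase p) / 2) *
        bargmann f (phase p)) := by
    funext p
    rw [stft, stftAtom_eq_smul_bargmannKernel, map_smul, smul_eq_mul, bargmann]
  have h2 : Continuous (fun p : Rd d × Rd d => dot (phase p) (phase p)) := by
    have h3 := fun j => (continuous_apply j).comp (continuous_phase (d := d))
    exact continuous_finsetSum _ fun j _ => (h3 j).mul (h3 j)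
  have h4 := hf.comp continuous_phase
  simp only [Function.comp_def] at h4
  rw [h]
  fun_prop

theorem eLpNorm_stft {d : ℕ} (wt : Rd d × Rd d → ℝ) (f : 𝓢'(Rd d, ℂ)) :
    eLpNorm (fun p => stft f p * (wt p : ℂ)) 2 volume =
      ENNReal.ofReal ((2 * Real.pi) ^ (-(d : ℝ) / 2)) *
        eLpNorm (fun p => dilatedGauss (bargmann f) p * (wt p : ℂ)) 2 volume := by
  have hc : (0 : ℝ) ≤ (2 * Real.pi) ^ (-(d : ℝ) / 2) := by positivity
  rw [← Real.enorm_eq_ofReal hc, ← eLpNorm_const_smul]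
  refine eLpNorm_congr_norm_ae (Filter.Eventually.of_forall fun p => ?_)
  simp only [Pi.smul_apply]
  rw [norm_mul, norm_stft, norm_smul, norm_mul, Real.norm_of_nonneg hc, mul_assoc]

theorem mem_modulationSpace_iff {d : ℕ} (N : ℤ) {f : 𝓢'(Rd d, ℂ)}
    (hf : Differentiable ℂ (bargmann f)) :
    f ∈ modulationSpace (sigma (2 * (N : ℝ))) ↔ Summable (coeffTerm N (bargmann f)) := by
  rw [← memLp_dilatedGauss_iff N hf]
  have h1 := aestronglyMeasurable_mul_sigma N (continuous_stft hf.continuous)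
  have h2 := aestronglyMeasurable_mul_sigma N (continuous_dilatedGauss hf.continuous)
  have hc : (0 : ℝ) < (2 * Real.pi) ^ (-(d : ℝ) / 2) := by positivity
  have h3 := eLpNorm_stft (sigma (2 * (N : ℝ))) f
  change MemLp _ _ _ ↔ _
  rw [MemLp, MemLp, and_iff_right h1, and_iff_right h2, h3, ENNReal.mul_lt_top_iff]
  have h5 : ENNReal.ofReal ((2 * Real.pi) ^ (-(d : ℝ) / 2)) ≠ 0 := by simpa using hc
  constructor
  · rintro (h | h | h)
    · exact h.2
    · exact absurd h h5
    · simp [h]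
  · exact fun h => Or.inl ⟨ENNReal.ofReal_lt_top, h⟩

theorem modulationNorm_eq {d : ℕ} (wt : Rd d × Rd d → ℝ) (f : 𝓢'(Rd d, ℂ)) :
    modulationNorm wt f = (2 * Real.pi) ^ (-(d : ℝ) / 2) * normA wt (bargmann f) := by
  rw [modulationNorm, eLpNorm_stft, ENNReal.toReal_mul, ENNReal.toReal_ofReal (by positivity),
    normA]

/-! ### The Bargmann transform of a tempered distribution is entire -/

theorem norm_iteratedFDeriv_le_norm_iteratedDeriv {f : ℂ → ℂ} (hf : ContDiff ℂ ∞ f) (n : ℕ)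
    (u : ℂ) : ‖iteratedFDeriv ℝ n f u‖ = ‖iteratedDeriv n f u‖ := by
  have h : ContDiff ℂ n f := hf.of_le (by exact_mod_cast le_top)
  rw [← h.contDiffAt.restrictScalars_iteratedFDeriv (𝕜 := ℝ)]
  simp only [Function.comp_apply, ContinuousMultilinearMap.norm_restrictScalars]
  rw [norm_iteratedFDeriv_eq_norm_iteratedDeriv]

theorem norm_dot_toCd_le {d : ℕ} (w : Cd d) (y : Rd d) :
    ‖dot w (toCd y)‖ ≤ (∑ j, ‖w j‖) * ‖y‖ := by
  rw [Finset.sum_mul]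
  refine (norm_sum_le _ _).trans (Finset.sum_le_sum fun j _ => ?_)
  rw [norm_mul]
  gcongr
  simpa [toCd] using PiLp.norm_apply_le y j

theorem hasTemperateGrowth_coord {d : ℕ} (j : Fin d) :
    Function.HasTemperateGrowth (fun y : Rd d => ((y j : ℝ) : ℂ)) :=
  (Complex.ofRealCLM ∘L (EuclideanSpace.proj j : Rd d →L[ℝ] ℝ)).hasTemperateGrowth

theorem gaussian_apply {d : ℕ} (w : Cd d) (y : Rd d) :
    gaussian w y = Complex.exp (-((‖y‖ ^ 2 : ℝ) : ℂ) / 2 + dot w (toCd y)) := rfl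

theorem norm_gaussian {d : ℕ} (w : Cd d) (y : Rd d) :
    ‖gaussian w y‖ = Real.exp (-‖y‖ ^ 2 / 2 + (dot w (toCd y)).re) := by
  rw [gaussian_apply, Complex.norm_exp]
  have : (-((‖y‖ ^ 2 : ℝ) : ℂ) / 2) = ((-‖y‖ ^ 2 / 2 : ℝ) : ℂ) := by push_cast; ring
  rw [Complex.add_re, this, Complex.ofReal_re]

/-- Every derivative of exp at q is bounded by e^{Re q}, and the derivatives of q grow polynomially,
so a derivative of the Gaussian is at most a polynomial times e^{-|y|²/2 + K|y|}. The extra factor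
e^{a|y|} is needed to absorb the growth of `expRem` below. -/
theorem gaussian_exp_decay {d : ℕ} (w : Cd d) (k n : ℕ) (a : ℝ) :
    ∃ B : ℝ, ∀ y : Rd d,
      (1 + ‖y‖) ^ k * Real.exp (a * ‖y‖) * ‖iteratedFDeriv ℝ n (gaussian w) y‖ ≤ B := by
  let q : Rd d → ℂ := fun y => -((‖y‖ ^ 2 : ℝ) : ℂ) / 2 + dot w (toCd y)
  have hq : q.HasTemperateGrowth := by
    have h1 : Function.HasTemperateGrowth (fun y : Rd d => ‖y‖ ^ 2) := by fun_prop
    have h2 : Function.HasTemperateGrowth (fun y : Rd d => ((‖y‖ ^ 2 : ℝ) : ℂ)) :=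
      (Complex.ofRealCLM.hasTemperateGrowth).comp h1
    have h4 : Function.HasTemperateGrowth (fun y : Rd d => ∑ j, w j * (y j : ℂ)) :=
      Function.HasTemperateGrowth.sum fun j _ =>
        (Function.HasTemperateGrowth.const (w j)).fun_mul (hasTemperateGrowth_coord j)
    have h6 := ((Function.HasTemperateGrowth.const (-1 / 2 : ℂ)).fun_mul h2).fun_add h4
    convert! h6 using 2 with y
    simp only [q, dot, toCd]
    ring
  have hexpC : ContDiff ℂ ∞ Complex.exp := Complex.contDiff_exp
  have hexp : ContDiff ℝ ∞ Complex.exp := hexpC.restrict_scalars ℝ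
  obtain ⟨m, C, hC0, hC⟩ := hq.norm_iteratedFDeriv_le_uniform n
  set K : ℝ := ∑ j, ‖w j‖ with hK
  have hK0 : 0 ≤ K := Finset.sum_nonneg fun j _ => norm_nonneg _
  have hre : ∀ (i : ℕ) (y : Rd d),
      ‖iteratedFDeriv ℝ i Complex.exp (q y)‖ ≤ Real.exp (-‖y‖ ^ 2 / 2 + K * ‖y‖) := by
    intro i y
    rw [norm_iteratedFDeriv_le_norm_iteratedDeriv hexpC, iteratedDeriv_eq_iterate,
      Complex.iter_deriv_exp]
    refine (norm_gaussian w y).trans_le (Real.exp_le_exp.2 ?_)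
    linarith [(Complex.re_le_norm (dot w (toCd y))).trans (norm_dot_toCd_le w y)]
  let M : ℕ := k + m * n
  refine ⟨n.factorial * (C + 1) ^ n * (M.factorial * Real.exp (1 + (K + a + 1) ^ 2 / 2)),
    fun y => ?_⟩
  set r := ‖y‖ with hr
  have hr0 : 0 ≤ r := norm_nonneg y
  have hD : ∀ i, 1 ≤ i → i ≤ n → ‖iteratedFDeriv ℝ i q y‖ ≤ ((C + 1) * (1 + r) ^ m) ^ i := by
    intro i hi hin
    have h1 : 1 ≤ (1 + r) ^ m := one_le_pow₀ (by linarith)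
    have h2 : 1 ≤ (C + 1) * (1 + r) ^ m := by nlinarith
    refine (hC i hin y).trans ?_
    refine le_trans ?_ (le_self_pow₀ h2 (by omega))
    gcongr
    linarith
  have hmain := norm_iteratedFDeriv_comp_le hexp hq.1 (n := n) (by exact_mod_cast le_top) y
    (fun i _ => hre i y) hD
  have hMexp : (1 + r) ^ M ≤ M.factorial * Real.exp (1 + r) := by
    have := Real.pow_div_factorial_le_exp (1 + r) (by linarith) M
    rwa [div_le_iff₀ (by positivity), mul_comm] at this
  calc (1 + r) ^ k * Real.exp (a * r) * ‖iteratedFDeriv ℝ n (Complex.exp ∘ q) y‖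
      ≤ (1 + r) ^ k * Real.exp (a * r) * (n.factorial * Real.exp (-r ^ 2 / 2 + K * r)
          * ((C + 1) * (1 + r) ^ m) ^ n) := by gcongr
    _ = n.factorial * (C + 1) ^ n * ((1 + r) ^ M *
          (Real.exp (a * r) * Real.exp (-r ^ 2 / 2 + K * r))) := by
        simp only [M, mul_pow, pow_add, pow_mul]
        ring
    _ ≤ n.factorial * (C + 1) ^ n * ((M.factorial * Real.exp (1 + r))
          * (Real.exp (a * r) * Real.exp (-r ^ 2 / 2 + K * r))) := by gcongr
    _ = n.factorial * (C + 1) ^ n * (M.factorial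
          * Real.exp (1 + r + (a * r + (-r ^ 2 / 2 + K * r)))) := by
        rw [Real.exp_add (1 + r), Real.exp_add (a * r)]
        ring
    _ ≤ _ := by
        gcongr ?_ * (?_ * Real.exp ?_)
        nlinarith [sq_nonneg (r - (K + a + 1))]

/-- The second order remainder of the exponential series. -/
def expRem (u : ℂ) : ℂ := Complex.exp u - 1 - u

theorem contDiff_expRem : ContDiff ℂ ∞ expRem :=
  (Complex.contDiff_exp.sub contDiff_const).sub contDiff_id

/-- The subtraction 2 - n is truncated: each derivative lowers the order of vanishing at 0 by one
until none is left. -/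
theorem norm_iteratedDeriv_expRem_le (n : ℕ) (u : ℂ) :
    ‖iteratedDeriv n expRem u‖ ≤ ‖u‖ ^ (2 - n) * Real.exp ‖u‖ := by
  have h1 : deriv expRem = fun u => Complex.exp u - 1 := by
    funext u
    exact (((Complex.hasDerivAt_exp u).sub_const 1).sub (hasDerivAt_id u)).deriv
  have h2 : deriv (fun u => Complex.exp u - 1) = Complex.exp := by
    funext u
    exact ((Complex.hasDerivAt_exp u).sub_const 1).deriv
  match n with
  | 0 =>
    have h := Complex.norm_exp_sub_sum_le_norm_mul_exp u 2
    simpa [Finset.sum_range_succ, expRem, sub_sub] using h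
  | 1 =>
    have h := Complex.norm_exp_sub_sum_le_norm_mul_exp u 1
    simpa [h1] using h
  | n + 2 =>
    rw [iteratedDeriv_succ', iteratedDeriv_succ', h1, h2, iteratedDeriv_eq_iterate,
      Complex.iter_deriv_exp]
    simpa using Complex.norm_exp_le_exp_norm u

/-- The linear map `y ↦ ⟨h, y⟩`. -/
def dotCLM {d : ℕ} (h : Cd d) : Rd d →L[ℝ] ℂ :=
  ∑ j, (h j) • (Complex.ofRealCLM ∘L (EuclideanSpace.proj j : Rd d →L[ℝ] ℝ))

theorem dotCLM_apply {d : ℕ} (h : Cd d) (y : Rd d) : dotCLM h y = dot h (toCd y) := by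
  simp [dotCLM, dot, toCd]

theorem norm_dotCLM_le {d : ℕ} (h : Cd d) : ‖dotCLM h‖ ≤ d * ‖h‖ := by
  refine ContinuousLinearMap.opNorm_le_bound _ (by positivity) fun y => ?_
  rw [dotCLM_apply]
  refine (norm_dot_toCd_le h y).trans ?_
  gcongr
  refine (Finset.sum_le_sum fun j _ => norm_le_pi_norm h j).trans_eq ?_
  simp

/-- Differentiating n times loses up to n orders of vanishing, but the chain rule returns a factor
‖h‖^n. As ‖h‖ ≤ 1, the bound stays quadratic in h for every n. -/
theorem norm_iteratedFDeriv_expRem_dot_le {d : ℕ} (n : ℕ) {h : Cd d} (hh : ‖h‖ ≤ 1) (y : Rd d) :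
    ‖iteratedFDeriv ℝ n (expRem ∘ dotCLM h) y‖ ≤
      ‖h‖ ^ 2 * ((d + 1) ^ (n + 2) * (1 + ‖y‖) ^ 2 * Real.exp (d * ‖y‖)) := by
  have hc : ContDiff ℝ ∞ expRem := contDiff_expRem.restrict_scalars ℝ
  rw [(dotCLM h).iteratedFDeriv_comp_right hc y (i := n) (by exact_mod_cast le_top)]
  refine (ContinuousMultilinearMap.norm_compContinuousLinearMap_le _ _).trans ?_
  rw [Finset.prod_const, Finset.card_univ, Fintype.card_fin,
    norm_iteratedFDeriv_le_norm_iteratedDeriv contDiff_expRem]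
  have h1 := norm_dotCLM_le h
  have h2 : ‖dotCLM h y‖ ≤ d * ‖h‖ * ‖y‖ := (dotCLM h).le_of_opNorm_le h1 y
  have h3 : d * ‖h‖ * ‖y‖ ≤ d * ‖y‖ := by
    have : d * ‖h‖ ≤ d * 1 := by gcongr
    rw [mul_one] at this
    gcongr
  have hpow : ‖h‖ ^ (2 - n) * ‖h‖ ^ n ≤ ‖h‖ ^ 2 := by
    rw [← pow_add]
    exact pow_le_pow_of_le_one (norm_nonneg _) hh (by omega)
  have hd : (d : ℝ) ^ (2 - n) * (d : ℝ) ^ n ≤ (d + 1) ^ (n + 2) := by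
    rw [← pow_add]
    calc (d : ℝ) ^ (2 - n + n) ≤ (d + 1 : ℝ) ^ (2 - n + n) := by gcongr; linarith
      _ ≤ (d + 1 : ℝ) ^ (n + 2) := pow_le_pow_right₀ (by norm_cast; omega) (by omega)
  have hy : ‖y‖ ^ (2 - n) ≤ (1 + ‖y‖) ^ 2 :=
    (pow_le_pow_left₀ (norm_nonneg _) (by linarith) _).trans
      (pow_le_pow_right₀ (by linarith [norm_nonneg y]) (by omega))
  calc ‖iteratedDeriv n expRem (dotCLM h y)‖ * ‖dotCLM h‖ ^ n
      ≤ (‖dotCLM h y‖ ^ (2 - n) * Real.exp ‖dotCLM h y‖) * ‖dotCLM h‖ ^ n := by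
        gcongr
        exact norm_iteratedDeriv_expRem_le n _
    _ ≤ ((d * ‖h‖ * ‖y‖) ^ (2 - n) * Real.exp (d * ‖y‖)) * (d * ‖h‖) ^ n := by
        gcongr
        exact h2.trans h3
    _ = (‖h‖ ^ (2 - n) * ‖h‖ ^ n) * (((d : ℝ) ^ (2 - n) * (d : ℝ) ^ n) * ‖y‖ ^ (2 - n) *
          Real.exp (d * ‖y‖)) := by
        rw [mul_pow, mul_pow, mul_pow]
        ring
    _ ≤ _ := by gcongr

/-- Multiplication of Schwartz functions by a coordinate. -/
def coordMul {d : ℕ} (j : Fin d) : 𝓢(Rd d, ℂ) →L[ℂ] 𝓢(Rd d, ℂ) :=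
  SchwartzMap.smulLeftCLM ℂ (fun y : Rd d => ((y j : ℝ) : ℂ))

theorem coordMul_apply {d : ℕ} (j : Fin d) (φ : 𝓢(Rd d, ℂ)) (y : Rd d) :
    coordMul j φ y = (y j : ℂ) * φ y := by
  rw [coordMul, SchwartzMap.smulLeftCLM_apply_apply (hasTemperateGrowth_coord j), smul_eq_mul]

/-- The remainder in the first order expansion of `w ↦ gaussian w`. -/
def gaussianRem {d : ℕ} (w h : Cd d) : 𝓢(Rd d, ℂ) :=
  gaussian (w + h) - gaussian w - ∑ j, h j • coordMul j (gaussian w)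

theorem gaussianRem_apply {d : ℕ} (w h : Cd d) (y : Rd d) :
    gaussianRem w h y = gaussian w y * (expRem ∘ dotCLM h) y := by
  have h1 : gaussian (w + h) y = gaussian w y * Complex.exp (dot h (toCd y)) := by
    rw [gaussian_apply, gaussian_apply, ← Complex.exp_add]
    congr 1
    simp only [dot, Pi.add_apply, add_mul, Finset.sum_add_distrib]
    ring
  have h2 : (∑ j, h j • coordMul j (gaussian w)) y = gaussian w y * dot h (toCd y) := by
    simp only [sum_apply, smul_apply, coordMul_apply, dot, toCd,
      Finset.mul_sum, smul_eq_mul]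
    exact Finset.sum_congr rfl fun j _ => by ring
  rw [gaussianRem, sub_apply, sub_apply, h1, h2, Function.comp_apply,
    dotCLM_apply, expRem]
  ring

/-- Leibniz's rule for the product in `gaussianRem_apply`. The quadratic bound in every seminorm
says that w ↦ `gaussian w` is differentiable in the Schwartz topology. -/
theorem seminorm_gaussianRem_le {d : ℕ} (w : Cd d) (k n : ℕ) : ∃ B : ℝ, 0 ≤ B ∧
    ∀ h : Cd d, ‖h‖ ≤ 1 → SchwartzMap.seminorm ℂ k n (gaussianRem w h) ≤ ‖h‖ ^ 2 * B := by
  have hdec := fun i => gaussian_exp_decay w (k + 2) i d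
  choose B hB using hdec
  have hB0 : ∀ i, 0 ≤ B i := fun i => le_trans (by positivity) (hB i 0)
  refine ⟨∑ i ∈ Finset.range (n + 1), (n.choose i : ℝ) * B i * (d + 1) ^ (n - i + 2),
    Finset.sum_nonneg fun i _ => by have := hB0 i; positivity, fun h hh => ?_⟩
  refine SchwartzMap.seminorm_le_bound ℂ k n _ (mul_nonneg (by positivity)
    (Finset.sum_nonneg fun i _ => by have := hB0 i; positivity)) fun y => ?_
  have hfun : (gaussianRem w h : Rd d → ℂ) =
      fun y => gaussian w y * (expRem ∘ dotCLM h) y := funext (gaussianRem_apply w h)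
  have hc : ContDiff ℝ ∞ (expRem ∘ dotCLM h) :=
    (contDiff_expRem.restrict_scalars ℝ).comp (dotCLM h).contDiff
  rw [hfun]
  refine (mul_le_mul_of_nonneg_left (norm_iteratedFDeriv_mul_le ((gaussian w).smooth ⊤) hc y
    (n := n) (by exact_mod_cast le_top)) (by positivity)).trans ?_
  rw [Finset.mul_sum, Finset.mul_sum]
  refine Finset.sum_le_sum fun i _ => ?_
  calc ‖y‖ ^ k * ((n.choose i : ℝ) * ‖iteratedFDeriv ℝ i (gaussian w) y‖ *
        ‖iteratedFDeriv ℝ (n - i) (expRem ∘ dotCLM h) y‖)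
      ≤ (1 + ‖y‖) ^ k * ((n.choose i : ℝ) * ‖iteratedFDeriv ℝ i (gaussian w) y‖ *
        (‖h‖ ^ 2 * ((d + 1) ^ (n - i + 2) * (1 + ‖y‖) ^ 2 * Real.exp (d * ‖y‖)))) := by
        gcongr
        · linarith
        · exact norm_iteratedFDeriv_expRem_dot_le (n - i) hh y
    _ = ‖h‖ ^ 2 * ((n.choose i : ℝ) * ((1 + ‖y‖) ^ (k + 2) * Real.exp (d * ‖y‖) *
        ‖iteratedFDeriv ℝ i (gaussian w) y‖) * (d + 1) ^ (n - i + 2)) := by ring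
    _ ≤ _ := by
        gcongr
        exact hB i y

/-- A tempered distribution is bounded by finitely many Schwartz seminorms, so applying f to the
first order expansion leaves a remainder O(‖h‖²). -/
theorem differentiable_apply_gaussian {d : ℕ} (f : 𝓢'(Rd d, ℂ)) :
    Differentiable ℂ (fun w : Cd d => f (gaussian w)) := by
  intro w
  have hf : Continuous (fun φ : 𝓢(Rd d, ℂ) => f φ) := f.continuous
  obtain ⟨s, C, -, hsC⟩ := Seminorm.bound_of_continuous (schwartz_withSeminorms ℂ (Rd d) ℂ)
    ((normSeminorm ℂ ℂ).comp (f : 𝓢(Rd d, ℂ) →ₗ[ℂ] ℂ)) (continuous_norm.comp hf)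
  have hrem := fun i : ℕ × ℕ => seminorm_gaussianRem_le w i.1 i.2
  choose B hB0 hB using hrem
  set L : Cd d →L[ℂ] ℂ := ∑ j, f (coordMul j (gaussian w)) • ContinuousLinearMap.proj (R := ℂ) j
  refine HasFDerivAt.differentiableAt (f' := L) ?_
  rw [hasFDerivAt_iff_isLittleO_nhds_zero]
  have hbig : (fun h : Cd d => f (gaussian (w + h)) - f (gaussian w) - L h) =O[nhds 0]
      (fun h : Cd d => ‖h‖ ^ 2) := by
    refine Asymptotics.IsBigO.of_bound (C * ∑ i ∈ s, B i) ?_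
    filter_upwards [Metric.ball_mem_nhds (0 : Cd d) one_pos] with h hh
    have hh1 : ‖h‖ ≤ 1 := by simpa using (mem_ball_zero_iff.1 hh).le
    have h1 : f (gaussian (w + h)) - f (gaussian w) - L h = f (gaussianRem w h) := by
      simp [gaussianRem, L, map_sub, map_sum, mul_comm]
    have h2 : ‖f (gaussianRem w h)‖ ≤
        C * (s.sup (schwartzSeminormFamily ℂ (Rd d) ℂ)) (gaussianRem w h) :=
      hsC (gaussianRem w h)
    have h3 : (s.sup (schwartzSeminormFamily ℂ (Rd d) ℂ)) (gaussianRem w h) ≤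
        ‖h‖ ^ 2 * ∑ i ∈ s, B i := by
      refine Seminorm.finset_sup_apply_le (mul_nonneg (by positivity)
        (Finset.sum_nonneg fun i _ => hB0 i)) fun i hi => ?_
      refine (hB i h hh1).trans ?_
      gcongr
      exact Finset.single_le_sum (fun i _ => hB0 i) hi
    rw [h1, Real.norm_of_nonneg (by positivity)]
    exact h2.trans ((mul_le_mul_of_nonneg_left h3 C.coe_nonneg).trans_eq (by ring))
  refine hbig.trans_isLittleO ?_
  exact Asymptotics.isLittleO_norm_pow_id one_lt_two

theorem differentiable_bargmann {d : ℕ} (f : 𝓢'(Rd d, ℂ)) : Differentiable ℂ (bargmann f) := by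
  have h : bargmann f = fun z => ((gaussConst d : ℂ) * Complex.exp (-dot z z / 2)) *
      f (gaussian (fun j => (Real.sqrt 2 : ℂ) * z j)) := by
    funext z
    rw [bargmann, bargmannKernel, map_smul, smul_eq_mul]
  have h1 : Differentiable ℂ (fun z : Cd d => dot z z) := by
    unfold dot
    fun_prop
  have h2 := (differentiable_apply_gaussian f).comp
    (g := fun w : Cd d => f (gaussian w)) (f := fun z : Cd d => fun j => (Real.sqrt 2 : ℂ) * z j)
    (by fun_prop)
  rw [h]
  have h3 : Differentiable ℂ (fun z : Cd d => -dot z z / 2) := by fun_prop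
  exact (h3.cexp.const_mul _).mul h2

/-! ### The Bargmann transform of Schwartz functions -/

/-- The tempered distribution `ψ ↦ ∫ ψ φ` of a Schwartz function `φ`. -/
def distr {d : ℕ} : 𝓢(Rd d, ℂ) →L[ℂ] 𝓢'(Rd d, ℂ) :=
  SchwartzMap.toTemperedDistributionCLM (Rd d) ℂ volume

theorem distr_apply {d : ℕ} (φ ψ : 𝓢(Rd d, ℂ)) : distr φ ψ = ∫ y, ψ y * φ y := by
  simp [distr]

/-- The operator `y_j - ∂_j` on Schwartz functions. -/
def creation {d : ℕ} (j : Fin d) : 𝓢(Rd d, ℂ) →L[ℂ] 𝓢(Rd d, ℂ) :=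
  coordMul j - LineDeriv.lineDerivOpCLM ℂ 𝓢(Rd d, ℂ) (EuclideanSpace.single j (1 : ℝ))

theorem lineDeriv_gaussian {d : ℕ} (w : Cd d) (j : Fin d) (y : Rd d) :
    lineDeriv ℝ (gaussian w) y (EuclideanSpace.single j (1 : ℝ)) =
      (w j - (y j : ℂ)) * gaussian w y := by
  have h1 : ∀ t : ℝ, gaussian w (y + t • EuclideanSpace.single j (1 : ℝ)) =
      Complex.exp (-((‖y‖ ^ 2 + 2 * (t * y j) + t ^ 2 : ℝ) : ℂ) / 2 +
        (dot w (toCd y) + t * w j)) := by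
    intro t
    have h2 : ‖y + t • EuclideanSpace.single j (1 : ℝ)‖ ^ 2 = ‖y‖ ^ 2 + 2 * (t * y j) + t ^ 2 := by
      rw [norm_add_sq_real, inner_smul_right, norm_smul]
      simp [EuclideanSpace.inner_single_right]
    have h3 : dot w (toCd (y + t • EuclideanSpace.single j (1 : ℝ))) =
        dot w (toCd y) + t * w j := by
      rw [← dotCLM_apply, ← dotCLM_apply, map_add, map_smul,
        dotCLM_apply w (EuclideanSpace.single j 1)]
      simp [dot, toCd, mul_comm, apply_ite Complex.ofReal]
    rw [gaussian_apply, h2, h3]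
  rw [lineDeriv, funext h1]
  have h4 : HasDerivAt (fun t : ℝ => -((‖y‖ ^ 2 + 2 * (t * y j) + t ^ 2 : ℝ) : ℂ) / 2 +
        (dot w (toCd y) + t * w j)) (w j - (y j : ℂ)) 0 := by
    have h5 : HasDerivAt (fun t : ℂ => -(((‖y‖ ^ 2 : ℝ) : ℂ) + 2 * (t * (y j : ℂ)) + t ^ 2) / 2 +
        (dot w (toCd y) + t * w j)) (w j - (y j : ℂ)) ((0 : ℝ) : ℂ) := by
      have h6 := ((((((hasDerivAt_id ((0 : ℝ) : ℂ)).mul_const (y j : ℂ)).const_mul 2).const_add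
        ((‖y‖ ^ 2 : ℝ) : ℂ)).add ((hasDerivAt_id ((0 : ℝ) : ℂ)).pow 2)).neg.div_const 2).add
        (((hasDerivAt_id ((0 : ℝ) : ℂ)).mul_const (w j)).const_add (dot w (toCd y)))
      convert! h6 using 1
      simp
      ring
    have h7 := h5.comp_ofReal
    convert! h7 using 1
    funext t
    push_cast
    rfl
  rw [h4.cexp.deriv, gaussian_apply]
  simp
  ring

/-- Integration by parts moves y_j - ∂_j onto the Gaussian as y_j + ∂_j, of which `gaussian w` is an
eigenfunction with eigenvalue w_j. -/
theorem distr_creation_gaussian {d : ℕ} (j : Fin d) (φ : 𝓢(Rd d, ℂ)) (w : Cd d) :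
    distr (creation j φ) (gaussian w) = w j * distr φ (gaussian w) := by
  set e : Rd d := EuclideanSpace.single j (1 : ℝ)
  have h1 : distr (coordMul j φ) (gaussian w) = distr φ (coordMul j (gaussian w)) := by
    rw [distr_apply, distr_apply]
    refine integral_congr_ae (Filter.Eventually.of_forall fun y => ?_)
    simp only [coordMul_apply]
    ring
  have h2 : distr (LineDeriv.lineDerivOpCLM ℂ 𝓢(Rd d, ℂ) e φ) (gaussian w) =
      distr φ (-LineDeriv.lineDerivOp e (gaussian w)) := by
    have h := TemperedDistribution.lineDerivOp_toTemperedDistributionCLM_eq (μ := volume) φ e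
    have h3 := congrArg (fun u : 𝓢'(Rd d, ℂ) => u (gaussian w)) h
    exact h3.symm
  have h3 : coordMul j (gaussian w) - -LineDeriv.lineDerivOp e (gaussian w) = w j • gaussian w := by
    ext y
    have h4 : LineDeriv.lineDerivOp e (gaussian w) y = (w j - (y j : ℂ)) * gaussian w y :=
      (SchwartzMap.lineDerivOp_apply e (gaussian w) y).trans (lineDeriv_gaussian w j y)
    rw [sub_neg_eq_add, add_apply, h4, coordMul_apply, smul_apply, smul_eq_mul]
    ring
  calc distr (creation j φ) (gaussian w)
      = distr (coordMul j φ) (gaussian w) -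
          distr (LineDeriv.lineDerivOpCLM ℂ 𝓢(Rd d, ℂ) e φ) (gaussian w) := by
        rw [creation, sub_apply, map_sub]
        rfl
    _ = distr φ (w j • gaussian w) := by rw [h1, h2, ← map_sub, h3]
    _ = _ := by rw [map_smul, smul_eq_mul]

theorem bargmann_eq {d : ℕ} (f : 𝓢'(Rd d, ℂ)) (z : Cd d) :
    bargmann f z = ((gaussConst d : ℂ) * Complex.exp (-dot z z / 2)) *
      f (gaussian (fun j => (Real.sqrt 2 : ℂ) * z j)) := by
  rw [bargmann, bargmannKernel, map_smul, smul_eq_mul]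

theorem bargmann_distr_creation {d : ℕ} (j : Fin d) (φ : 𝓢(Rd d, ℂ)) (z : Cd d) :
    bargmann (distr (creation j φ)) z = (Real.sqrt 2 : ℂ) * z j * bargmann (distr φ) z := by
  rw [bargmann_eq, bargmann_eq, distr_creation_gaussian]
  ring

/-- Completing the square, |`gaussian w`| is e^{|Re w|²/2} times a standard Gaussian translated by
Re w, and the integral ignores the translation. -/
theorem norm_distr_gaussian_le {d : ℕ} (φ : 𝓢(Rd d, ℂ)) (w : Cd d) :
    ‖distr φ (gaussian w)‖ ≤ SchwartzMap.seminorm ℂ 0 0 φ *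
      (Real.exp ((∑ j, (w j).re ^ 2) / 2) * ∫ y : Rd d, Real.exp (-‖y‖ ^ 2 / 2)) := by
  set x : Rd d := WithLp.toLp 2 fun j => (w j).re with hx
  have hx2 : ‖x‖ ^ 2 = ∑ j, (w j).re ^ 2 := by
    rw [EuclideanSpace.norm_sq_eq]
    simp [hx]
  have hg : ∀ y, ‖gaussian w y‖ = Real.exp ((∑ j, (w j).re ^ 2) / 2) *
      Real.exp (-‖y - x‖ ^ 2 / 2) := by
    intro y
    have h1 : (dot w (toCd y)).re = inner ℝ y x := by
      simp [dot, toCd, PiLp.inner_apply, hx]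
    rw [norm_gaussian, ← Real.exp_add, norm_sub_sq_real, ← hx2, h1]
    congr 1
    ring
  rw [distr_apply, ← integral_const_mul, ← integral_const_mul]
  rw [← integral_sub_right_eq_self (μ := volume) (fun y : Rd d => SchwartzMap.seminorm ℂ 0 0 φ *
    (Real.exp ((∑ j, (w j).re ^ 2) / 2) * Real.exp (-‖y‖ ^ 2 / 2))) x]
  simp only [← hg]
  refine norm_integral_le_of_norm_le (((gaussian w).integrable (μ := volume)).norm.const_mul _)
    (Filter.Eventually.of_forall fun y => ?_)
  rw [norm_mul, mul_comm]
  gcongr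
  exact SchwartzMap.norm_le_seminorm ℂ φ y

/-- For w = √2 z the growth e^{|Re z|²} meets the modulus e^{|z|²/2 - |Re z|²} of e^{-⟨z,z⟩/2}; the
factor e^{-|z|²/2} cancels exactly what is left. -/
theorem norm_bargmann_distr_le {d : ℕ} (φ : 𝓢(Rd d, ℂ)) (z : Cd d) :
    ‖bargmann (distr φ) z‖ * Real.exp (-sqNorm z / 2) ≤
      gaussConst d * (∫ y : Rd d, Real.exp (-‖y‖ ^ 2 / 2)) * SchwartzMap.seminorm ℂ 0 0 φ := by
  have hc : 0 ≤ gaussConst d := by unfold gaussConst; positivity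
  have h2 : (Real.sqrt 2) ^ 2 = 2 := Real.sq_sqrt zero_le_two
  have h3 : (∑ j, ((Real.sqrt 2 : ℂ) * z j).re ^ 2) / 2 = ∑ j, (z j).re ^ 2 := by
    rw [Finset.sum_div]
    refine Finset.sum_congr rfl fun j _ => ?_
    rw [Complex.re_ofReal_mul, mul_pow, h2]
    ring
  have h4 : (-dot z z / 2).re = sqNorm z / 2 - ∑ j, (z j).re ^ 2 := by
    have : (dot z z).re = 2 * (∑ j, (z j).re ^ 2) - sqNorm z := by
      rw [dot, Complex.re_sum, sqNorm, Finset.mul_sum, ← Finset.sum_sub_distrib]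
      refine Finset.sum_congr rfl fun j _ => ?_
      rw [← Complex.normSq_eq_norm_sq, Complex.normSq_apply, Complex.mul_re]
      ring
    rw [Complex.div_ofNat_re, Complex.neg_re, this]
    ring
  have h5 := norm_distr_gaussian_le φ (fun j => (Real.sqrt 2 : ℂ) * z j)
  rw [h3] at h5
  rw [bargmann_eq, norm_mul, norm_mul, Complex.norm_real, Real.norm_of_nonneg hc,
    Complex.norm_exp, h4]
  set I := ∫ y : Rd d, Real.exp (-‖y‖ ^ 2 / 2)
  set S := ∑ j, (z j).re ^ 2
  calc gaussConst d * Real.exp (sqNorm z / 2 - S) *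
        ‖distr φ (gaussian fun j => (Real.sqrt 2 : ℂ) * z j)‖ * Real.exp (-sqNorm z / 2)
      ≤ gaussConst d * Real.exp (sqNorm z / 2 - S) *
        (SchwartzMap.seminorm ℂ 0 0 φ * (Real.exp S * I)) * Real.exp (-sqNorm z / 2) := by
        gcongr
    _ = gaussConst d * I * SchwartzMap.seminorm ℂ 0 0 φ *
        (Real.exp (sqNorm z / 2 - S) * Real.exp S * Real.exp (-sqNorm z / 2)) := by ring
    _ = _ := by
        rw [← Real.exp_add, ← Real.exp_add]
        have : sqNorm z / 2 - S + S + -sqNorm z / 2 = 0 := by ring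
        rw [this, Real.exp_zero, mul_one]

/-- Applying y_j - ∂_j twice multiplies |𝔙φ| by 2|z_j|²; adding the bounds for φ itself and for all
j gains one factor 1 + 2|z|². Continuity of q and q 0 = 0 are all that the continuity of the
functional in `exists_bargmann_eq` requires. -/
theorem exists_decay_bargmann_distr (d K : ℕ) : ∃ q : 𝓢(Rd d, ℂ) → ℝ, Continuous q ∧ q 0 = 0 ∧
    ∀ φ z, (1 + 2 * sqNorm z) ^ K * (‖bargmann (distr φ) z‖ * Real.exp (-sqNorm z / 2)) ≤ q φ := by
  induction K with
  | zero =>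
    refine ⟨fun φ => gaussConst d * (∫ y : Rd d, Real.exp (-‖y‖ ^ 2 / 2)) *
      SchwartzMap.seminorm ℂ 0 0 φ, ?_, by simp, fun φ z => ?_⟩
    · exact continuous_const.mul ((schwartz_withSeminorms ℂ (Rd d) ℂ).continuous_seminorm (0, 0))
    · rw [pow_zero, one_mul]
      exact norm_bargmann_distr_le φ z
  | succ K ih =>
    obtain ⟨q, hq, hq0, hle⟩ := ih
    refine ⟨fun φ => q φ + ∑ j, q (creation j (creation j φ)), ?_, by simp [hq0], fun φ z => ?_⟩
    · exact hq.add (continuous_finsetSum _ fun j _ =>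
        hq.comp ((creation j).continuous.comp (creation j).continuous))
    · have h1 : ∀ j, ‖bargmann (distr (creation j (creation j φ))) z‖ =
          2 * ‖z j‖ ^ 2 * ‖bargmann (distr φ) z‖ := by
        intro j
        rw [bargmann_distr_creation, bargmann_distr_creation, norm_mul, norm_mul, norm_mul,
          norm_mul, Complex.norm_real, Real.norm_of_nonneg (Real.sqrt_nonneg 2)]
        linear_combination ‖z j‖ ^ 2 * ‖bargmann (distr φ) z‖ * Real.mul_self_sqrt zero_le_two
      have h2 := fun j => hle (creation j (creation j φ)) z
      simp only [h1] at h2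
      refine le_trans (le_of_eq ?_) (add_le_add (hle φ z) (Finset.sum_le_sum fun j _ => h2 j))
      rw [← Finset.mul_sum, ← Finset.sum_mul, ← Finset.sum_mul, ← Finset.mul_sum]
      change _ = _ + _ * (2 * sqNorm z * _ * _)
      ring

theorem memLp_sigma_neg (d : ℕ) :
    MemLp (sigma (d := d) (2 * ((-(d + 1 : ℕ) : ℤ) : ℝ))) 2 volume := by
  have h0 : (volume : Measure (Rd d × Rd d)).IsAddHaarMeasure :=
    inferInstanceAs ((volume : Measure (Rd d)).prod (volume : Measure (Rd d))).IsAddHaarMeasure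
  have hc := continuous_sigma (d := d) (-(d + 1 : ℕ) : ℤ)
  rw [memLp_two_iff_integrable_sq hc.aestronglyMeasurable]
  have h1 := integrable_rpow_neg_one_add_norm_sq (E := Rd d × Rd d) (μ := volume)
    (r := ((4 * (d + 1) : ℕ) : ℝ)) (by
      rw [Module.finrank_prod, finrank_euclideanSpace, Fintype.card_fin]
      norm_cast
      omega)
  refine h1.mono' (hc.pow 2).aestronglyMeasurable (Filter.Eventually.of_forall fun p => ?_)
  have h2 : -((4 * (d + 1) : ℕ) : ℝ) / 2 = ((-(2 * (d + 1) : ℕ) : ℤ) : ℝ) := by push_cast; ring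
  have ht := sqNorm_nonneg (phase p)
  -- The product carries the sup norm, which is at most the Euclidean length occurring in σ;
  -- negative exponents reverse the comparison.
  have h3 : 1 + ‖p‖ ^ 2 ≤ 1 + 2 * sqNorm (phase p) := by
    rw [sqNorm_phase, Prod.norm_def]
    rcases max_choice ‖p.1‖ ‖p.2‖ with h | h <;> rw [h] <;>
      linarith [sq_nonneg ‖p.1‖, sq_nonneg ‖p.2‖]
  rw [h2, Real.rpow_intCast, sigma_eq, Real.norm_of_nonneg (by positivity), zpow_neg, zpow_neg,
    zpow_natCast, zpow_natCast, inv_pow, ← pow_mul, mul_comm (d + 1) 2]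
  gcongr

theorem exists_coeffNorm_bargmann_distr_le (d : ℕ) (N : ℤ) : ∃ q : 𝓢(Rd d, ℂ) → ℝ, Continuous q ∧
    q 0 = 0 ∧ ∀ φ, Summable (coeffTerm N (bargmann (distr φ))) ∧
      coeffNorm N (bargmann (distr φ)) ≤ q φ := by
  -- The power `N.toNat` offsets the weight, also for negative N, and the remaining d + 1 powers
  -- give square integrability on ℝ^{2d}.
  obtain ⟨q, hq, hq0, hle⟩ := exists_decay_bargmann_distr d (N.toNat + (d + 1))
  obtain ⟨C, hC, hequiv⟩ := exists_coeffNorm_equiv_normA d N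
  set g := sigma (d := d) (2 * ((-(d + 1 : ℕ) : ℤ) : ℝ)) with hg
  have hgL : MemLp g 2 volume := memLp_sigma_neg d
  refine ⟨fun φ => C * (q φ * (eLpNorm g 2 volume).toReal), by fun_prop, by simp [hq0],
    fun φ => ?_⟩
  have hF := differentiable_bargmann (distr φ)
  have hq_nonneg : 0 ≤ q φ := by
    refine le_trans ?_ (hle φ 0)
    have := sqNorm_nonneg (0 : Cd d)
    positivity
  have hpt : ∀ p, ‖dilatedGauss (bargmann (distr φ)) p * (sigma (2 * (N : ℝ)) p : ℂ)‖ ≤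
      q φ * ‖g p‖ := by
    intro p
    have ht := sqNorm_nonneg (phase p)
    have h1 := hle φ (phase p)
    have hz : 0 ≤ (1 + 2 * sqNorm (phase p)) ^ N := by positivity
    rw [dilatedGauss_eq, sigma_eq, norm_mul, norm_mul, Complex.norm_real, Complex.norm_real,
      Real.norm_of_nonneg (Real.exp_nonneg _), Real.norm_of_nonneg hz, hg, sigma_eq,
      Real.norm_of_nonneg (by positivity), zpow_neg, zpow_natCast, ← div_eq_mul_inv,
      le_div_iff₀ (by positivity)]
    refine le_trans ?_ h1
    have h2 : (1 + 2 * sqNorm (phase p)) ^ N ≤ (1 + 2 * sqNorm (phase p)) ^ N.toNat := by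
      rw [← zpow_natCast]
      exact zpow_le_zpow_right₀ (by linarith) (Int.self_le_toNat N)
    rw [pow_add _ N.toNat]
    calc _ = (1 + 2 * sqNorm (phase p)) ^ N * (1 + 2 * sqNorm (phase p)) ^ (d + 1) *
          (‖bargmann (distr φ) (phase p)‖ * Real.exp (-sqNorm (phase p) / 2)) := by ring
      _ ≤ _ := by gcongr
  have hmem : MemLp (fun p => dilatedGauss (bargmann (distr φ)) p *
      (sigma (2 * (N : ℝ)) p : ℂ)) 2 volume :=
    hgL.of_le_mul (aestronglyMeasurable_mul_sigma N (continuous_dilatedGauss hF.continuous))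
      (Filter.Eventually.of_forall hpt)
  have hs := (memLp_dilatedGauss_iff N hF).1 hmem
  refine ⟨hs, ?_⟩
  have h1 := (hequiv _ hF hs).1
  rw [inv_mul_le_iff₀ hC] at h1
  refine h1.trans (mul_le_mul_of_nonneg_left ?_ hC.le)
  have h2 := eLpNorm_le_mul_eLpNorm_of_ae_le_mul (Filter.Eventually.of_forall hpt)
    (2 : ENNReal) (μ := volume)
  have h3 := ENNReal.toReal_mono (ENNReal.mul_ne_top ENNReal.ofReal_ne_top hgL.2.ne) h2
  rw [ENNReal.toReal_mul, ENNReal.toReal_ofReal hq_nonneg] at h3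
  exact h3

/-! ### The reproducing kernel and surjectivity by duality. -/

theorem listDeriv_exp_dot {d : ℕ} (z : Cd d) (α : Fin d → ℕ) (l : List (Fin d)) :
    listDeriv α l (fun w => Complex.exp (dot z w)) =
      (l.map fun j => z j ^ α j).prod • fun w => Complex.exp (dot z w) := by
  have h1 : ∀ j, partialDeriv j (fun w => Complex.exp (dot z w)) =
      z j • fun w => Complex.exp (dot z w) := by
    intro j
    funext w
    have h2 : ∀ t : ℂ, dot z (w + t • Pi.single j (1 : ℂ)) = dot z w + t * z j := by
      intro t
      simp [dot, mul_add, Finset.sum_add_distrib, Pi.single_apply, mul_comm]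
    simp only [partialDeriv, lineDeriv, h2]
    have h3 : HasDerivAt (fun t : ℂ => dot z w + t * z j) (z j) 0 := by
      simpa using ((hasDerivAt_id (0 : ℂ)).mul_const (z j)).const_add (dot z w)
    rw [h3.cexp.deriv]
    simp [mul_comm]
  have h4 : ∀ (j : Fin d) (k : ℕ), (partialDeriv j)^[k] (fun w => Complex.exp (dot z w)) =
      z j ^ k • fun w => Complex.exp (dot z w) := by
    intro j k
    induction k with
    | zero => simp
    | succ k ih => rw [Function.iterate_succ_apply', ih, partialDeriv_smul, h1, smul_smul, pow_succ]
  induction l with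
  | nil => simp [listDeriv]
  | cons j l ih =>
    have h5 : ∀ (c : ℂ) (G : Cd d → ℂ), (partialDeriv j)^[α j] (c • G) =
        c • (partialDeriv j)^[α j] G := fun c G => by
      have h := listDeriv_smul c G α [j]
      exact h
    rw [listDeriv_cons, ih, h5, h4, smul_smul, List.map_cons, List.prod_cons, mul_comm]

theorem taylorCoeff_exp_dot {d : ℕ} (z : Cd d) (α : Fin d → ℕ) :
    taylorCoeff (fun w => Complex.exp (dot z w)) α = monomialFn α z := by
  have h := congrFun (listDeriv_exp_dot z α (List.finRange d)) 0
  change listDeriv α (List.finRange d) (fun w => Complex.exp (dot z w)) 0 / _ = _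
  rw [h, ← Fin.prod_univ_def]
  simp [dot, monomialFn]

/-- A Gaussian integral with linear term √2(z + w). The result is the reproducing kernel in bilinear
form, and its Taylor coefficients in w are the normalised monomials at z. -/
theorem bargmann_distr_bargmannKernel {d : ℕ} (z w : Cd d) :
    bargmann (distr (bargmannKernel z)) w = Complex.exp (dot z w) := by
  set s : ℂ := (Real.sqrt 2 : ℂ) with hs
  have hs2 : s ^ 2 = 2 := by
    rw [hs, ← Complex.ofReal_pow, Real.sq_sqrt zero_le_two, Complex.ofReal_ofNat]
  have hc : (gaussConst d : ℂ) ^ 2 * (Real.pi : ℂ) ^ ((d : ℂ) / 2) = 1 := by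
    have h1 : (Real.pi : ℂ) ^ ((d : ℂ) / 2) = ((Real.pi ^ ((d : ℝ) / 2) : ℝ) : ℂ) := by
      rw [Complex.ofReal_cpow Real.pi_pos.le]
      push_cast
      rfl
    rw [h1, gaussConst, ← Complex.ofReal_pow, ← Complex.ofReal_mul, ← Real.rpow_natCast,
      ← Real.rpow_mul Real.pi_pos.le, ← Real.rpow_add Real.pi_pos]
    have : -(d : ℝ) / 4 * (2 : ℕ) + d / 2 = 0 := by push_cast; ring
    rw [this, Real.rpow_zero, Complex.ofReal_one]
  have hint : ∫ y : Rd d, Complex.exp (-1 * ((‖y‖ ^ 2 : ℝ) : ℂ) + dot (fun j => s * (z j + w j))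
      (toCd y)) = (Real.pi : ℂ) ^ ((d : ℂ) / 2) *
        Complex.exp ((dot z z + dot w w) / 2 + dot z w) := by
    have h := GaussianFourier.integral_cexp_neg_mul_sum_add (b := 1) (ι := Fin d) (by simp)
      (fun j => s * (z j + w j))
    rw [div_one, Fintype.card_fin] at h
    rw [← (PiLp.volume_preserving_toLp (Fin d)).integral_comp
      (MeasurableEquiv.toLp 2 _).measurableEmbedding]
    have h2 : (∑ j, (s * (z j + w j)) ^ 2) / (4 * 1) = (dot z z + dot w w) / 2 + dot z w := by
      simp only [dot, mul_pow, hs2, ← Finset.sum_add_distrib, Finset.sum_div]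
      exact Finset.sum_congr rfl fun j _ => by ring
    rw [h2] at h
    rw [← h]
    refine integral_congr_ae (Filter.Eventually.of_forall fun v => ?_)
    simp only [EuclideanSpace.norm_sq_eq, Real.norm_eq_abs, sq_abs, dot, toCd]
    push_cast
    rfl
  rw [bargmann, distr_apply]
  have hpt : ∀ y, bargmannKernel w y * bargmannKernel z y =
      ((gaussConst d : ℂ) ^ 2 * Complex.exp (-(dot z z + dot w w) / 2)) *
        Complex.exp (-1 * ((‖y‖ ^ 2 : ℝ) : ℂ) + dot (fun j => s * (z j + w j)) (toCd y)) := by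
    intro y
    have h3 : dot (fun j => s * (z j + w j)) (toCd y) =
        s * dot w (toCd y) + s * dot z (toCd y) := by
      simp only [dot, Finset.mul_sum, ← Finset.sum_add_distrib]
      exact Finset.sum_congr rfl fun j _ => by ring
    rw [bargmannKernel_apply, bargmannKernel_apply, h3, mul_mul_mul_comm, ← Complex.exp_add,
      mul_assoc ((gaussConst d : ℂ) ^ 2), ← Complex.exp_add, ← sq]
    congr 2
    ring
  simp only [hpt]
  rw [integral_const_mul, hint, mul_mul_mul_comm, hc, one_mul, ← Complex.exp_add]
  congr 1
  ring

/-- Cauchy–Schwarz after inserting ⟨α⟩^N ⟨α⟩^{-N}. -/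
theorem coeff_pairing {d : ℕ} (N : ℤ) {F G : Cd d → ℂ} (hF : Summable (coeffTerm N F))
    (hG : Summable (coeffTerm (-N) G)) :
    Summable (fun α => taylorCoeff F α * taylorCoeff G α) ∧
      ‖∑' α, taylorCoeff F α * taylorCoeff G α‖ ≤ coeffNorm N F * coeffNorm (-N) G := by
  have hsq : ∀ (M : ℤ) (H : Cd d → ℂ) (α : Fin d → ℕ),
      (‖taylorCoeff H α‖ * japanese α ^ M) ^ (2 : ℝ) = coeffTerm M H α := by
    intro M H α
    rw [Real.rpow_ofNat, coeffTerm, mul_pow, mul_comm 2 M, zpow_mul, zpow_ofNat]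
  have hj : ∀ α : Fin d → ℕ, 0 < japanese α := fun α => by linarith [one_le_japanese α]
  have hmul : ∀ α : Fin d → ℕ, (‖taylorCoeff F α‖ * japanese α ^ N) *
      (‖taylorCoeff G α‖ * japanese α ^ (-N)) = ‖taylorCoeff F α * taylorCoeff G α‖ := by
    intro α
    have h : japanese α ^ N ≠ 0 := (zpow_pos (hj α) N).ne'
    rw [zpow_neg, norm_mul]
    field_simp
  have h := Real.summable_and_inner_le_Lp_mul_Lq_tsum_of_nonneg Real.HolderConjugate.two_two
    (f := fun α => ‖taylorCoeff F α‖ * japanese α ^ N)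
    (g := fun α => ‖taylorCoeff G α‖ * japanese α ^ (-N))
    (fun α => mul_nonneg (norm_nonneg _) (zpow_pos (hj α) _).le)
    (fun α => mul_nonneg (norm_nonneg _) (zpow_pos (hj α) _).le)
    (by simpa only [hsq] using hF) (by simpa only [hsq] using hG)
  simp only [hsq, hmul, ← Real.sqrt_eq_rpow] at h
  exact ⟨h.1.of_norm, (norm_tsum_le_tsum_norm h.1).trans h.2⟩

theorem taylorCoeff_bargmann_add {d : ℕ} (f g : 𝓢'(Rd d, ℂ)) (α : Fin d → ℕ) :
    taylorCoeff (bargmann (f + g)) α = taylorCoeff (bargmann f) α + taylorCoeff (bargmann g) α :=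
  taylorCoeff_add (differentiable_bargmann f) (differentiable_bargmann g) α

theorem taylorCoeff_bargmann_smul {d : ℕ} (c : ℂ) (f : 𝓢'(Rd d, ℂ)) (α : Fin d → ℕ) :
    taylorCoeff (bargmann (c • f)) α = c * taylorCoeff (bargmann f) α :=
  taylorCoeff_smul c (bargmann f) α

/-- Every entire function whose Taylor coefficients are square summable against a power weight is
the Bargmann transform of a tempered distribution. -/
theorem exists_bargmann_eq {d : ℕ} (N : ℤ) {F : Cd d → ℂ} (hF : Differentiable ℂ F)
    (hs : Summable (coeffTerm N F)) : ∃ f : 𝓢'(Rd d, ℂ), bargmann f = F := by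
  obtain ⟨q, hq, hq0, hle⟩ := exists_coeffNorm_bargmann_distr_le d (-N)
  have hpair := fun φ => coeff_pairing N hs (hle φ).1
  -- The pairing has no complex conjugation, in accordance with the bilinear duality that defines 𝔙.
  let L : 𝓢(Rd d, ℂ) →ₗ[ℂ] ℂ :=
    { toFun := fun φ => ∑' α, taylorCoeff F α * taylorCoeff (bargmann (distr φ)) α
      map_add' := fun φ ψ => by
        rw [← (hpair φ).1.tsum_add (hpair ψ).1]
        simp only [map_add, taylorCoeff_bargmann_add, mul_add]
      map_smul' := fun c φ => by
        rw [RingHom.id_apply, smul_eq_mul, ← tsum_mul_left]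
        simp only [map_smul, taylorCoeff_bargmann_smul, mul_left_comm] }
  have hL : Continuous L := by
    refine continuous_of_continuousAt_zero L ?_
    rw [ContinuousAt, map_zero]
    refine squeeze_zero_norm (a := fun φ => coeffNorm N F * q φ) (fun φ => ?_) ?_
    · refine (hpair φ).2.trans ?_
      exact mul_le_mul_of_nonneg_left (hle φ).2 (Real.sqrt_nonneg _)
    · have h := (hq.const_mul (coeffNorm N F)).tendsto 0
      rwa [hq0, mul_zero] at h
  refine ⟨ContinuousLinearMap.toPointwiseConvergenceCLM _ _ _ _ ⟨L, hL⟩, funext fun z => ?_⟩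
  change ∑' α, taylorCoeff F α * taylorCoeff (bargmann (distr (bargmannKernel z))) α = F z
  -- On the kernel at z, the coefficients of the second factor are the monomials at z, so the
  -- pairing is the Taylor series of F.
  rw [funext (bargmann_distr_bargmannKernel z)]
  simp only [taylorCoeff_exp_dot]
  exact (hasSum_taylorCoeff hF z).tsum_eq

/-! ### Identification of the two spaces and comparison of their norms. -/

theorem spaceA0_eq (d : ℕ) (N : ℤ) : spaceA0 (d := d) (sigma (2 * (N : ℝ))) =
    {F : Cd d → ℂ | Differentiable ℂ F ∧ Summable (coeffTerm N F)} := by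
  ext F
  constructor
  · rintro ⟨f, hf, rfl⟩
    exact ⟨differentiable_bargmann f, (mem_modulationSpace_iff N (differentiable_bargmann f)).1 hf⟩
  · rintro ⟨hF, hs⟩
    obtain ⟨f, rfl⟩ := exists_bargmann_eq N hF hs
    exact ⟨f, (mem_modulationSpace_iff N hF).2 hs, rfl⟩

theorem spaceA_eq (d : ℕ) (N : ℤ) : spaceA (d := d) (sigma (2 * (N : ℝ))) =
    {F : Cd d → ℂ | Differentiable ℂ F ∧ Summable (coeffTerm N F)} := by
  ext F
  exact and_congr_right fun hF => memLp_dilatedGauss_iff N hF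

theorem exists_coeffNorm_equiv_modulationNorm (d : ℕ) (N : ℤ) : ∃ C : ℝ, 0 < C ∧
    ∀ f ∈ modulationSpace (d := d) (sigma (2 * (N : ℝ))),
      C⁻¹ * coeffNorm N (bargmann f) ≤ modulationNorm (sigma (2 * (N : ℝ))) f ∧
      modulationNorm (sigma (2 * (N : ℝ))) f ≤ C * coeffNorm N (bargmann f) := by
  obtain ⟨C, hC, h⟩ := exists_coeffNorm_equiv_normA d N
  set κ : ℝ := (2 * Real.pi) ^ (-(d : ℝ) / 2) with hκ
  have hκ0 : 0 < κ := by positivity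
  refine ⟨max (κ * C) (κ⁻¹ * C), by positivity, fun f hf => ?_⟩
  have hF := differentiable_bargmann f
  obtain ⟨h1, h2⟩ := h _ hF ((mem_modulationSpace_iff N hF).1 hf)
  have h0 : 0 ≤ coeffNorm N (bargmann f) := Real.sqrt_nonneg _
  rw [modulationNorm_eq]
  constructor
  · calc (max (κ * C) (κ⁻¹ * C))⁻¹ * coeffNorm N (bargmann f)
        ≤ (κ⁻¹ * C)⁻¹ * coeffNorm N (bargmann f) := by
          gcongr
          exact le_max_right _ _
      _ = κ * (C⁻¹ * coeffNorm N (bargmann f)) := by rw [mul_inv, inv_inv, mul_assoc]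
      _ ≤ _ := by gcongr
  · calc κ * normA (sigma (2 * (N : ℝ))) (bargmann f) ≤ κ * (C * coeffNorm N (bargmann f)) := by
          gcongr
      _ = κ * C * coeffNorm N (bargmann f) := by ring
      _ ≤ _ := by
          gcongr
          exact le_max_left _ _

end Bargmann

end

theorem mainTheorem4 (d : ℕ) (N : ℤ) :
    -- the Taylor expansion of entire functions
    (∀ F : Bargmann.Cd d → ℂ, Differentiable ℂ F → ∀ z : Bargmann.Cd d,
      HasSum (fun α : Fin d → ℕ => Bargmann.taylorCoeff F α * Bargmann.monomialFn α z) (F z)) ∧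
    -- the description of `A₀(σ_{2N}, L²)` through the Taylor coefficients
    (Bargmann.spaceA0 (d := d) (Bargmann.sigma (2 * (N : ℝ))) =
      {F : Bargmann.Cd d → ℂ | Differentiable ℂ F ∧ Summable (Bargmann.coeffTerm N F)}) ∧
    -- the coefficient norm is equivalent to the norm of `A(σ_{2N}, L²)`
    (∃ C : ℝ, 0 < C ∧ ∀ F ∈ Bargmann.spaceA0 (d := d) (Bargmann.sigma (2 * (N : ℝ))),
      C⁻¹ * Bargmann.coeffNorm N F ≤ Bargmann.normA (Bargmann.sigma (2 * (N : ℝ))) F ∧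
      Bargmann.normA (Bargmann.sigma (2 * (N : ℝ))) F ≤ C * Bargmann.coeffNorm N F) ∧
    -- the coefficient norm is equivalent to the norm of `A₀(σ_{2N}, L²)`, that is, of `M²_{2N}`
    (∃ C : ℝ, 0 < C ∧ ∀ f ∈ Bargmann.modulationSpace (d := d) (Bargmann.sigma (2 * (N : ℝ))),
      C⁻¹ * Bargmann.coeffNorm N (Bargmann.bargmann f) ≤
        Bargmann.modulationNorm (Bargmann.sigma (2 * (N : ℝ))) f ∧
      Bargmann.modulationNorm (Bargmann.sigma (2 * (N : ℝ))) f ≤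
        C * Bargmann.coeffNorm N (Bargmann.bargmann f)) ∧
    -- `A(σ_{2N}, L²) = A₀(σ_{2N}, L²)`, where the right side is the image of `M²_{2N}`
    (Bargmann.spaceA (d := d) (Bargmann.sigma (2 * (N : ℝ))) =
      Bargmann.spaceA0 (Bargmann.sigma (2 * (N : ℝ)))) := by
  refine ⟨fun F hF z => Bargmann.hasSum_taylorCoeff hF z, Bargmann.spaceA0_eq d N, ?_,
    Bargmann.exists_coeffNorm_equiv_modulationNorm d N,
    (Bargmann.spaceA_eq d N).trans (Bargmann.spaceA0_eq d N).symm⟩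
  obtain ⟨C, hC, h⟩ := Bargmann.exists_coeffNorm_equiv_normA d N
  refine ⟨C, hC, fun F hF => ?_⟩
  rw [Bargmann.spaceA0_eq] at hF
  exact h F hF.1 hF.2
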